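/- Let $\sigma=(\sigma_{ij})$ be a non-zero complex symmetric $n\times n$ matrix. On $\mathbb{C}^{4n}=\mathbb{R}^{8n}$ with coordinates $z^1,\dots,z^{4n}$ consider the function $$f(z)=2\,\mathrm{Re}\sum_{c=1}^{2n} z^{c}\,\overline{z^{c+2n}}+\Bigl|\sum_{i,j=1}^n\sigma_{ij}z^iz^{j+n}\Bigr|^2$$ and the indefinite Kähler metric with potential $f$, $$g=\sum_{A,B=1}^{4n} h_{AB}\,dz^A\cdot d\overline{z}^B,\qquad h_{AB}=\frac{\partial^2 f}{\partial z^A\,\partial\overline{z}^B},$$ that is, $g(v,w)=\mathrm{Re}\sum_{A,B}h_{AB}v^A\overline{w^B}$. For $a,b\in\mathbb{R}$ let $\phi_{a,b}$ be the diagonal complex linear map of $\mathbb{C}^{4n}=(\mathbb{C}^n)^4$ that multiplies the four blocks by $e^{a}$, $e^{b}$, $e^{a+2b}$, $e^{2a+b}$; it is a homothety, $\phi_{a,b}^*g=e^{2(a+b)}g$. Let $a,b>0$ be fixed, let $\Gamma_{a,b}$ be the cyclic group generated by $\phi_{a,b}$ acting on $\widetilde M=\mathbb{R}^{8n}\setminus\{0\}$,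 and let $M_{a,b}=\widetilde M/\Gamma_{a,b}$ with projection $\pi:\widetilde M\to M_{a,b}$. Then: 1. $M_{a,b}$ is a compact complex manifold (with the complex structure $J$ for which $\pi$ is locally biholomorphic), and it is diffeomorphic to $S^1\times S^{8n-1}$. 2. The semi-Riemannian metrics $\hat g$ on $M_{a,b}$ for which $\pi^*\hat g=e^{2u}g$ for some smooth function $u$ on $\widetilde M$ form a conformal structure, that is, they are exactly the metrics conformal to one semi-Riemannian metric on $M_{a,b}$. For every metric $\hat g$ in this conformal structure: - $\hat g$ has signature $(4n,4n)$; - $\hat g$ is not conformally flat, that is, its Weyl tensor does not vanish identically; - $\hat g$ is locally conformal to a Ricci-flat Kähler metric (Kähler with respect to $J$); - $J$ preserves the conformal structure: $\hat g(Jv,Jw)=\hat g(v,w)$ for all tangent vectors $v,w$ at the same point. 3. For each real $t\neq 0$, the map $\phi_{0,t}$ has a fixed point in $\widetilde M$, and it induces a map $\psi_t:M_{a,b}\to M_{a,b}$ which has a fixed point and is an essential conformal transformation: $\psi_t$ is a diffeomorphism with $\psi_t^*\hat g=e^{2\lambda}\hat g$ for a smooth function $\lambda$, and there is no metric in the conformal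 structure for which the group generated by $\psi_t$ consists of isometries. -/

import Mathlib

open scoped Manifold ContDiff

set_option maxSynthPendingDepth 3

noncomputable section

/-! ### Metrics on open sets of a vector space, in coordinates

`G : E → E →L[ℝ] E →L[ℝ] ℝ` is the coefficient function of a semi-Riemannian metric. -/

namespace MetricCoord

variable {E : Type*} [NormedAddCommGroup E] [NormedSpace ℝ E]

/-- The Christoffel symbols of the first kind,
`koszul G y v w u = (1/2) (D_v G (w,u) + D_w G (v,u) - D_u G (v,w))` at the point `y`. -/
def koszul (G : E → E →L[ℝ] E →L[ℝ] ℝ) (y : E) : E →L[ℝ] E →L[ℝ] E →L[ℝ] ℝ :=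
  let D : E →L[ℝ] E →L[ℝ] E →L[ℝ] ℝ := fderiv ℝ G y
  let D' : E →L[ℝ] E →L[ℝ] E →L[ℝ] ℝ :=
    ((ContinuousLinearMap.flipₗᵢ ℝ E E ℝ).toContinuousLinearEquiv :
      (E →L[ℝ] E →L[ℝ] ℝ) →L[ℝ] (E →L[ℝ] E →L[ℝ] ℝ)) ∘L D.flip
  (1 / 2 : ℝ) • (D + D.flip - D')

theorem koszul_apply (G : E → E →L[ℝ] E →L[ℝ] ℝ) (y v w u : E) :
    koszul G y v w u =
      (1 / 2 : ℝ) * (fderiv ℝ G y v w u + fderiv ℝ G y w v u - fderiv ℝ G y u v w) := by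
  simp [koszul]

/-- The Christoffel symbols `Γ y v w` of the Levi-Civita connection; `(G y).inverse` is the
inverse `E* → E` of `v ↦ G y v` (raising an index). -/
def christoffel (G : E → E →L[ℝ] E →L[ℝ] ℝ) (y : E) : E →L[ℝ] E →L[ℝ] E :=
  (ContinuousLinearMap.compL ℝ E (E →L[ℝ] ℝ) E (G y).inverse) ∘L koszul G y

theorem christoffel_apply (G : E → E →L[ℝ] E →L[ℝ] ℝ) (y v w : E) :
    christoffel G y v w = (G y).inverse (koszul G y v w) := rfl

/-- The curvature `R(v,w)u = ∇_v ∇_w u - ∇_w ∇_v u` for constant fields `v`, `w`, `u`,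
as a linear map in `v`. -/
def curvature (G : E → E →L[ℝ] E →L[ℝ] ℝ) (y w u : E) : E →ₗ[ℝ] E where
  toFun v := fderiv ℝ (christoffel G) y v w u - fderiv ℝ (christoffel G) y w v u
    + christoffel G y v (christoffel G y w u) - christoffel G y w (christoffel G y v u)
  map_add' v v' := by simp only [map_add, add_apply]; abel
  map_smul' c v := by
    simp only [map_smul, smul_apply, RingHom.id_apply, smul_add, smul_sub]

/-- The Ricci tensor `Ric(w,u) = tr (v ↦ R(v,w)u)`. -/
def ricci (G : E → E →L[ℝ] E →L[ℝ] ℝ) (y w u : E) : ℝ :=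
  LinearMap.trace ℝ E (curvature G y w u)

/-- The scalar curvature `tr_G Ric = ∑ G^{ij} Ric_{ij}`; the sum is over a basis `b` of `E`,
`G^{ij} = bⁱ (G⁻¹ bʲ)` where `bⁱ` is the dual basis. -/
def scal [FiniteDimensional ℝ E] (G : E → E →L[ℝ] E →L[ℝ] ℝ) (y : E) : ℝ :=
  ∑ i, ∑ j, (Module.finBasis ℝ E).coord i
      ((G y).inverse (LinearMap.toContinuousLinearMap ((Module.finBasis ℝ E).coord j)))
    * ricci G y (Module.finBasis ℝ E i) (Module.finBasis ℝ E j)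

/-- The Weyl tensor (with all indices down) of a metric in dimension at least three. -/
def weyl [FiniteDimensional ℝ E] (G : E → E →L[ℝ] E →L[ℝ] ℝ) (y v w u x : E) : ℝ :=
  G y (curvature G y w u v) x
    - (1 / ((Module.finrank ℝ E : ℝ) - 2)) *
      (ricci G y w u * G y v x - ricci G y v u * G y w x
        + G y w u * ricci G y v x - G y v u * ricci G y w x)
    + (scal G y / (((Module.finrank ℝ E : ℝ) - 1) * ((Module.finrank ℝ E : ℝ) - 2))) *
      (G y w u * G y v x - G y v u * G y w x)

/-- `G` is a Kähler metric at `y` for the (constant) complex structure `v ↦ i v` of the complex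
vector space `E`: it is Hermitian, and the exterior derivative of the Kähler form
`ω(v,w) = G(iv,w)` vanishes. -/
def IsKaehlerAt [NormedSpace ℂ E] (G : E → E →L[ℝ] E →L[ℝ] ℝ) (y : E) : Prop :=
  (∀ v w : E, G y (Complex.I • v) (Complex.I • w) = G y v w) ∧
  ∀ u v w : E, fderiv ℝ G y u (Complex.I • v) w + fderiv ℝ G y v (Complex.I • w) u
    + fderiv ℝ G y w (Complex.I • u) v = 0

end MetricCoord

/-! ### Semi-Riemannian metrics on manifolds -/

section Manifolds

variable {E : Type*} [NormedAddCommGroup E] [NormedSpace ℝ E]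
  {M : Type*} [TopologicalSpace M] [ChartedSpace E M]

variable (E M) in
/-- Fields of bilinear forms on the tangent spaces of a manifold `M` modelled on `E`. (In Mathlib,
`TangentSpace 𝓘(ℝ, E) x` is `E`, identified with the tangent space by the chart `chartAt E x`.) -/
abbrev BilinField : Type _ :=
  ∀ x : M, TangentSpace 𝓘(ℝ, E) x →L[ℝ] TangentSpace 𝓘(ℝ, E) x →L[ℝ] ℝ

/-- The field `e^{2u} g`. -/
def conformalScale (u : M → ℝ) (g : BilinField E M) : BilinField E M :=
  fun x => Real.exp (2 * u x) • g x

/-- The coefficients of `g` in the chart `chartAt E p`: the pull-back of `g` to the target of the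
chart by the inverse of the chart. -/
def chartCoeff (g : BilinField E M) (p : M) (y : E) : E →L[ℝ] E →L[ℝ] ℝ :=
  let D : E →L[ℝ] E := mfderiv 𝓘(ℝ, E) 𝓘(ℝ, E) (chartAt E p).symm y
  let B : E →L[ℝ] E →L[ℝ] ℝ := g ((chartAt E p).symm y)
  B.bilinearComp D D

/-- A semi-Riemannian metric: smooth, symmetric and nondegenerate. -/
structure IsSemiRiemannian (g : BilinField E M) : Prop where
  symm : ∀ x v w, g x v w = g x w v
  nondegenerate : ∀ x v, (∀ w, g x v w = 0) → v = 0
  smooth : ∀ p : M, ContDiffOn ℝ ∞ (chartCoeff g p) (chartAt E p).target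

/-- `g` has signature `(p,q)` at every point: there are orthonormal bases of the tangent spaces
with `p` vectors of square `1` and `q` vectors of square `-1`. -/
def HasSignature (g : BilinField E M) (p q : ℕ) : Prop :=
  ∀ x : M, ∃ b : Module.Basis (Fin p ⊕ Fin q) ℝ (TangentSpace 𝓘(ℝ, E) x),
    ∀ i j, g x (b i) (b j) = if i = j then Sum.elim (fun _ => 1) (fun _ => -1) i else 0

/-- The conformal structure (conformal class) of `g`: all metrics `e^{2u} g`, `u` smooth. -/
def conformalClass (g : BilinField E M) : Set (BilinField E M) :=
  {g' | IsSemiRiemannian g' ∧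
    ∃ u : M → ℝ, ContMDiff 𝓘(ℝ, E) 𝓘(ℝ, ℝ) ∞ u ∧ g' = conformalScale u g}

/-- `g` is conformally flat: its Weyl tensor vanishes identically (in dimension at least four). -/
def IsConformallyFlat [FiniteDimensional ℝ E] (g : BilinField E M) : Prop :=
  ∀ (p : M) (v w u x : E), MetricCoord.weyl (chartCoeff g p) (chartAt E p p) v w u x = 0

/-- `g` is locally conformal to a Ricci-flat Kähler metric: every point has an open neighbourhood
`U` with a smooth function `u` on it, such that the metric `e^{2u} g` on `U` is Ricci-flat, and
Kähler for the complex structure of the complex manifold `M`. -/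
def IsLocallyConformallyRicciFlatKaehler [NormedSpace ℂ E] (g : BilinField E M) : Prop :=
  ∀ p : M, ∃ U : Set M, IsOpen U ∧ p ∈ U ∧ ∃ u : M → ℝ, ContMDiffOn 𝓘(ℝ, E) 𝓘(ℝ, ℝ) ∞ u U ∧
    ∀ q ∈ U,
      (∀ v w : E,
        MetricCoord.ricci (chartCoeff (conformalScale u g) q) (chartAt E q q) v w = 0) ∧
      MetricCoord.IsKaehlerAt (chartCoeff (conformalScale u g) q) (chartAt E q q)

/-- The complex structure `J` of the complex manifold `M` on the tangent space at `x`: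
multiplication by `i` in the holomorphic chart `chartAt E x`. -/
def complexStructure [NormedSpace ℂ E] (x : M) (v : TangentSpace 𝓘(ℝ, E) x) :
    TangentSpace 𝓘(ℝ, E) x :=
  let v' : E := v
  Complex.I • v'

/-- `f` is a conformal transformation of `(M, g)`: a diffeomorphism with `f^* g = e^{2u} g`
for a smooth function `u`. -/
def IsConformalTransformation (g : BilinField E M) (f : Equiv.Perm M) : Prop :=
  ContMDiff 𝓘(ℝ, E) 𝓘(ℝ, E) ∞ f ∧ ContMDiff 𝓘(ℝ, E) 𝓘(ℝ, E) ∞ f.symm ∧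
  ∃ u : M → ℝ, ContMDiff 𝓘(ℝ, E) 𝓘(ℝ, ℝ) ∞ u ∧ ∀ x v w,
    g (f x) (mfderiv 𝓘(ℝ, E) 𝓘(ℝ, E) f x v) (mfderiv 𝓘(ℝ, E) 𝓘(ℝ, E) f x w)
      = Real.exp (2 * u x) * g x v w

/-- `f` is an isometry of `(M, g)`. -/
def IsIsometryOf (g : BilinField E M) (f : Equiv.Perm M) : Prop :=
  ContMDiff 𝓘(ℝ, E) 𝓘(ℝ, E) ∞ f ∧ ContMDiff 𝓘(ℝ, E) 𝓘(ℝ, E) ∞ f.symm ∧ ∀ x v w,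
    g (f x) (mfderiv 𝓘(ℝ, E) 𝓘(ℝ, E) f x v) (mfderiv 𝓘(ℝ, E) 𝓘(ℝ, E) f x w) = g x v w

/-- A group of conformal transformations is essential if it is not a group of isometries
of any metric in the conformal class. -/
def IsEssentialGroup (g : BilinField E M) (G : Subgroup (Equiv.Perm M)) : Prop :=
  ¬ ∃ g' ∈ conformalClass g, ∀ f ∈ G, IsIsometryOf g' f

/-- A conformal transformation is essential if the group that it generates is essential. -/
def IsEssential (g : BilinField E M) (f : Equiv.Perm M) : Prop :=
  IsEssentialGroup g (Subgroup.zpowers f)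

end Manifolds

/-! ### The Kähler metric on `ℂ^{4n}` and the quotient -/

section Example

/-- `ℂ^{4n}`; the coordinate `z^{i+kn}` is `z (k, i)`, for `k = 0,1,2,3` and `1 ≤ i ≤ n`. -/
abbrev C4 (n : ℕ) : Type := Fin 4 × Fin n → ℂ

variable {n : ℕ}

/-- The quadratic polynomial `σ_{ij} z^i z^{j+n}`. -/
def sigmaPoly (σ : Matrix (Fin n) (Fin n) ℂ) (z : C4 n) : ℂ :=
  ∑ i, ∑ j, σ i j * z (0, i) * z (1, j)

/-- The Kähler potential `2 Re (∑_{a ≤ 2n} z^a conj(z^{a+2n})) + |σ(z)|²`. -/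
def kaehlerPotential (σ : Matrix (Fin n) (Fin n) ℂ) (z : C4 n) : ℝ :=
  2 * (∑ i, (z (0, i) * star (z (2, i)) + z (1, i) * star (z (3, i)))).re
    + ‖sigmaPoly σ z‖ ^ 2

/-- The Wirtinger derivative `∂F/∂z^A = (1/2)(∂F/∂x^A - i ∂F/∂y^A)`. -/
def wirtinger (A : Fin 4 × Fin n) (F : C4 n → ℂ) (z : C4 n) : ℂ :=
  (1 / 2) * (fderiv ℝ F z (Pi.single A 1) - Complex.I * fderiv ℝ F z (Pi.single A Complex.I))

/-- The Wirtinger derivative `∂F/∂conj(z^A) = (1/2)(∂F/∂x^A + i ∂F/∂y^A)`. -/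
def wirtingerBar (A : Fin 4 × Fin n) (F : C4 n → ℂ) (z : C4 n) : ℂ :=
  (1 / 2) * (fderiv ℝ F z (Pi.single A 1) + Complex.I * fderiv ℝ F z (Pi.single A Complex.I))

/-- The coefficients `h_{AB} = ∂² f / ∂z^A ∂conj(z^B)`. -/
def hermCoeff (σ : Matrix (Fin n) (Fin n) ℂ) (A B : Fin 4 × Fin n) (z : C4 n) : ℂ :=
  wirtinger A (wirtingerBar B (fun x => (kaehlerPotential σ x : ℂ))) z

/-- The metric `g = h_{AB} dz^A · dconj(z^B)` (symmetric product of forms), that is,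
`g(v,w) = Re (h_{AB} v^A conj(w^B))`. -/
def kaehlerMetric (σ : Matrix (Fin n) (Fin n) ℂ) (z v w : C4 n) : ℝ :=
  (∑ A, ∑ B, hermCoeff σ A B z * v A * star (w B)).re

/-- `ℝ^{8n} ∖ {0} = ℂ^{4n} ∖ {0}` as an open submanifold of `ℂ^{4n}`. -/
def puncturedC4 (n : ℕ) : TopologicalSpace.Opens (C4 n) :=
  ⟨{0}ᶜ, isOpen_compl_singleton⟩

/-- The exponents `a`, `b`, `a + 2b`, `2a + b` of the four diagonal blocks of `φ_{a,b}`. -/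
def weight (a b : ℝ) : Fin 4 → ℝ := ![a, b, a + 2 * b, 2 * a + b]

/-- The diagonal linear map `φ_{a,b} = diag(e^a, e^b, e^{a+2b}, e^{2a+b})` of `ℂ^{4n}`. -/
def phiLin (a b : ℝ) : C4 n →L[ℂ] C4 n :=
  ContinuousLinearMap.pi fun A =>
    (Real.exp (weight a b A.1) : ℂ) • ContinuousLinearMap.proj (R := ℂ) A

theorem phiLin_apply (a b : ℝ) (z : C4 n) (A : Fin 4 × Fin n) :
    phiLin a b z A = (Real.exp (weight a b A.1) : ℂ) * z A := rfl

theorem phiLin_neg_phiLin (a b : ℝ) (z : C4 n) : phiLin (-a) (-b) (phiLin a b z) = z := by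
  funext A
  have h : weight (-a) (-b) A.1 = - weight a b A.1 := by
    obtain ⟨k, i⟩ := A
    fin_cases k <;> simp [weight] <;> ring
  rw [phiLin_apply, phiLin_apply, h, ← mul_assoc, ← Complex.ofReal_mul, ← Real.exp_add]
  simp

theorem phiLin_phiLin_neg (a b : ℝ) (z : C4 n) : phiLin a b (phiLin (-a) (-b) z) = z := by
  simpa using phiLin_neg_phiLin (-a) (-b) z

theorem phiLin_mem (a b : ℝ) (z : puncturedC4 n) : phiLin a b z.1 ∈ puncturedC4 n := by
  intro h
  have h0 : phiLin a b z.1 = 0 := h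
  apply z.2
  have := phiLin_neg_phiLin a b z.1
  rw [h0, map_zero] at this
  exact this.symm

/-- The transformation of `ℝ^{8n} ∖ {0}` given by `φ_{a,b}`. -/
def phi (a b : ℝ) : Equiv.Perm (puncturedC4 n) where
  toFun z := ⟨phiLin a b z.1, phiLin_mem a b z⟩
  invFun z := ⟨phiLin (-a) (-b) z.1, phiLin_mem (-a) (-b) z⟩
  left_inv z := Subtype.ext (phiLin_neg_phiLin a b z.1)
  right_inv z := Subtype.ext (phiLin_phiLin_neg a b z.1)

/-- The cyclic group `Γ_{a,b}` generated by `φ_{a,b}`. -/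
abbrev Gam (n : ℕ) (a b : ℝ) : Subgroup (Equiv.Perm (puncturedC4 n)) :=
  Subgroup.zpowers (phi a b)

/-- The quotient space `M_{a,b} = (ℝ^{8n} ∖ {0}) / Γ_{a,b}`, with the quotient topology. -/
abbrev Mab (n : ℕ) (a b : ℝ) : Type :=
  MulAction.orbitRel.Quotient (Gam n a b) (puncturedC4 n)

/-- The projection `ℝ^{8n} ∖ {0} → M_{a,b}`. -/
def projMab (a b : ℝ) (z : puncturedC4 n) : Mab n a b :=
  Quotient.mk (MulAction.orbitRel (Gam n a b) (puncturedC4 n)) z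

/-- The conformal structure that the metric `g` defines on `M_{a,b}`: all semi-Riemannian metrics
on `M_{a,b}` whose pull-back to `ℝ^{8n} ∖ {0}` is `e^{2u} g` for a smooth function `u`. -/
def inducedStructure (σ : Matrix (Fin n) (Fin n) ℂ) (a b : ℝ) [ChartedSpace (C4 n) (Mab n a b)] :
    Set (BilinField (C4 n) (Mab n a b)) :=
  {g' | IsSemiRiemannian g' ∧
    ∃ u : puncturedC4 n → ℝ, ContMDiff 𝓘(ℝ, C4 n) 𝓘(ℝ, ℝ) ∞ u ∧
      ∀ (z : puncturedC4 n) (v w : TangentSpace 𝓘(ℝ, C4 n) z),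
        g' (projMab a b z) (mfderiv 𝓘(ℝ, C4 n) 𝓘(ℝ, C4 n) (projMab a b) z v)
            (mfderiv 𝓘(ℝ, C4 n) 𝓘(ℝ, C4 n) (projMab a b) z w)
          = Real.exp (2 * u z) * kaehlerMetric σ z.1
            (mfderiv 𝓘(ℝ, C4 n) 𝓘(ℝ, C4 n) (Subtype.val : puncturedC4 n → C4 n) z v)
            (mfderiv 𝓘(ℝ, C4 n) 𝓘(ℝ, C4 n) (Subtype.val : puncturedC4 n → C4 n) z w)}

end Example

end

/-! Differentiating the potential gives `g_z(v,w) = P(v,w) + Re (B(z,v) conj B(z,w))`. Here `P`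
(`pairing`) is a constant neutral form pairing block 0 with 2 and block 1 with 3, and `B`
(`sigmaForm`) is the complex bilinear polarization of `σ(z)`. It involves the first two blocks only,
so it kills the vertical vectors, those in the last two blocks, and these form a null space. Almost
everything follows from this.

The `g`-dual of `u ↦ Re (c conj B(y,u))` is a vertical vector `D(y,c)` (`sigmaDual`). The
Christoffel symbols are `D(y, B(v,w))`, their quadratic terms vanish, and the curvature is `R(v,w)u
= D(v, B(w,u)) - D(w, B(v,u))`. As a map in `v` it takes values in the vertical space and kills that
space, so its square is zero, its trace vanishes and `g` is Ricci-flat. The metric is Kähler because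
`B` is complex bilinear. A shear along vertical vectors carries `g_z` to `P`, which gives the
signature.

At a vertical point the horizontal space is null as well. On horizontal arguments every term of the
Weyl tensor other than the curvature then contains a vanishing factor, and a conformal change only
multiplies the lowered curvature by its factor. A component equal to a nonzero multiple of `|σ_ij|²`
remains (`confMetric_exists_weyl_ne_zero`).

The weights of the diagonal maps add up to `2(a+b)` on dual blocks and to `a+b` on the first two,
hence the homothety. For `a, b > 0` every flow line of `φ_{ta,tb}` in the punctured space crosses
the unit sphere exactly once. The crossing time `T` (`timeFn`) is smooth by the implicit function
theorem and satisfies `T ∘ φ_{sa,sb} = T + s`. Slabs where `T` varies by less than one parametrize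
the quotient, with group elements as transition maps; `T` mod 1 and the crossing point give the
diffeomorphism with circle times sphere. The metric `e^{-2(a+b)T} g` is invariant and descends to a
representative of the conformal structure.

The map `φ_{0,t}` commutes with the group and fixes a point of the first block, where its conformal
factor is `e^{2t}`. Rescaling the metric does not change the conformal factor at a fixed point, so
no metric of the class makes the induced map an isometry. -/

noncomputable section

/-! ### The Kähler metric in terms of bilinear forms -/

section MetricAlgebra

variable {n : ℕ}

/-- The involution of the coordinates that exchanges the dual blocks. -/
def dualIndex (A : Fin 4 × Fin n) : Fin 4 × Fin n := (A.1 + 2, A.2)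

theorem dualIndex_involutive : Function.Involutive (dualIndex (n := n)) := by
  rintro ⟨k, i⟩
  refine Prod.ext (?_ : k + 2 + 2 = k) rfl
  revert k
  decide

/-- The neutral Hermitian form of the constant part of the metric. -/
def hermPairing (v w : C4 n) : ℂ := ∑ A, v A * star (w (dualIndex A))

/-- The constant part of the metric. -/
def pairing : C4 n →L[ℝ] C4 n →L[ℝ] ℝ :=
  LinearMap.toContinuousBilinearMap <| LinearMap.mk₂ ℝ (fun v w => (hermPairing v w).re)
    (fun v v' w => by simp [hermPairing, add_mul, Finset.sum_add_distrib])
    (fun c v w => by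
      simp only [hermPairing, Pi.smul_apply, Complex.real_smul, mul_assoc, ← Finset.mul_sum,
        Complex.re_ofReal_mul, smul_eq_mul])
    (fun v w w' => by simp [hermPairing, mul_add, Finset.sum_add_distrib])
    (fun c v w => by
      simp only [hermPairing, Pi.smul_apply, Complex.real_smul, star_mul', Complex.star_def,
        Complex.conj_ofReal, mul_left_comm _ (c : ℂ), ← Finset.mul_sum,
        Complex.re_ofReal_mul, smul_eq_mul])

theorem pairing_apply (v w : C4 n) : pairing v w = (hermPairing v w).re := rfl

theorem pairing_symm (v w : C4 n) : pairing v w = pairing w v := by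
  rw [pairing_apply, pairing_apply, hermPairing, hermPairing, Complex.re_sum, Complex.re_sum,
    ← (Equiv.ofBijective _ dualIndex_involutive.bijective).sum_comp]
  refine Finset.sum_congr rfl fun A _ => ?_
  simp only [Equiv.ofBijective_apply, dualIndex_involutive A, Complex.star_def, Complex.mul_re,
    Complex.conj_re, Complex.conj_im]
  ring

theorem hermPairing_single (A : Fin 4 × Fin n) (c : ℂ) (w : C4 n) :
    hermPairing (Pi.single A c) w = c * star (w (dualIndex A)) := by
  simp [hermPairing, Pi.single_apply]

theorem pairing_single (A : Fin 4 × Fin n) (c : ℂ) (w : C4 n) :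
    pairing (Pi.single A c) w = (c * star (w (dualIndex A))).re := by
  rw [pairing_apply, hermPairing_single]

variable (σ : Matrix (Fin n) (Fin n) ℂ)

/-- The polarization of the quadratic polynomial `sigmaPoly σ`. -/
def sigmaForm : C4 n →L[ℝ] C4 n →L[ℝ] ℂ :=
  LinearMap.toContinuousBilinearMap <| LinearMap.mk₂ ℝ
    (fun u v => ∑ i, ∑ j, σ i j * (u (0, i) * v (1, j) + v (0, i) * u (1, j)))
    (fun u u' v => by
      simp only [← Finset.sum_add_distrib]
      exact Finset.sum_congr rfl fun i _ => Finset.sum_congr rfl fun j _ => by simp; ring)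
    (fun c u v => by
      simp only [Finset.smul_sum]
      exact Finset.sum_congr rfl fun i _ => Finset.sum_congr rfl fun j _ => by simp; ring)
    (fun u v v' => by
      simp only [← Finset.sum_add_distrib]
      exact Finset.sum_congr rfl fun i _ => Finset.sum_congr rfl fun j _ => by simp; ring)
    (fun c u v => by
      simp only [Finset.smul_sum]
      exact Finset.sum_congr rfl fun i _ => Finset.sum_congr rfl fun j _ => by simp; ring)

theorem sigmaForm_apply (u v : C4 n) :
    sigmaForm σ u v = ∑ i, ∑ j, σ i j * (u (0, i) * v (1, j) + v (0, i) * u (1, j)) := rfl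

theorem sigmaForm_symm (u v : C4 n) : sigmaForm σ u v = sigmaForm σ v u := by
  simp only [sigmaForm_apply, add_comm]

theorem sigmaForm_smul_right (c : ℂ) (u v : C4 n) :
    sigmaForm σ u (c • v) = c * sigmaForm σ u v := by
  simp only [sigmaForm_apply, Finset.mul_sum]
  exact Finset.sum_congr rfl fun i _ => Finset.sum_congr rfl fun j _ => by simp; ring

theorem sigmaForm_smul_left (c : ℂ) (u v : C4 n) :
    sigmaForm σ (c • u) v = c * sigmaForm σ u v := by
  rw [sigmaForm_symm, sigmaForm_smul_right, sigmaForm_symm]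

theorem sigmaPoly_eq (z : C4 n) : sigmaPoly σ z = (1 / 2) * sigmaForm σ z z := by
  simp only [sigmaForm_apply, sigmaPoly, Finset.mul_sum]
  exact Finset.sum_congr rfl fun i _ => Finset.sum_congr rfl fun j _ => by ring

theorem sigmaForm_eq_sum (u v : C4 n) :
    sigmaForm σ u v = ∑ A, v A * sigmaForm σ u (Pi.single A 1) := by
  conv_lhs => rw [show v = ∑ A, v A • (Pi.single A 1 : C4 n) by
    funext B; simp [Finset.sum_apply, Pi.single_apply]]
  simp only [map_sum, sigmaForm_smul_right]

/-- Vectors in the null subspace of the last two blocks. -/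
def IsVertical (v : C4 n) : Prop := ∀ i, v (0, i) = 0 ∧ v (1, i) = 0

/-- Vectors in the complementary null subspace of the first two blocks. -/
def IsHorizontal (v : C4 n) : Prop := ∀ i, v (2, i) = 0 ∧ v (3, i) = 0

variable {σ} in
theorem IsVertical.sigmaForm_right {v : C4 n} (hv : IsVertical v) (u : C4 n) :
    sigmaForm σ u v = 0 := by
  simp [sigmaForm_apply, fun i => (hv i).1, fun i => (hv i).2]

variable {σ} in
theorem IsVertical.sigmaForm_left {v : C4 n} (hv : IsVertical v) (u : C4 n) :
    sigmaForm σ v u = 0 := by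
  rw [sigmaForm_symm, hv.sigmaForm_right]

theorem hermPairing_eq (v w : C4 n) : hermPairing v w =
    ∑ i, (v (0, i) * star (w (2, i)) + v (1, i) * star (w (3, i))
      + v (2, i) * star (w (0, i)) + v (3, i) * star (w (1, i))) := by
  rw [hermPairing, Fintype.sum_prod_type_right]
  refine Finset.sum_congr rfl fun i _ => ?_
  rw [Fin.sum_univ_four]
  rfl

theorem IsVertical.pairing {v w : C4 n} (hv : IsVertical v) (hw : IsVertical w) :
    pairing v w = 0 := by
  simp [pairing_apply, hermPairing_eq, fun i => (hv i).1, fun i => (hv i).2, fun i => (hw i).1,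
    fun i => (hw i).2]

theorem IsHorizontal.pairing {v w : C4 n} (hv : IsHorizontal v) (hw : IsHorizontal w) :
    pairing v w = 0 := by
  simp [pairing_apply, hermPairing_eq, fun i => (hv i).1, fun i => (hv i).2, fun i => (hw i).1,
    fun i => (hw i).2]

/-- The vector that represents the form `u ↦ Re (c * conj (sigmaForm σ y u))`. -/
def sigmaDual : C4 n →L[ℝ] ℂ →L[ℝ] C4 n :=
  LinearMap.toContinuousBilinearMap <| LinearMap.mk₂ ℝ
    (fun y c A => c * (star (sigmaForm σ y (Pi.single (dualIndex A) 1))))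
    (fun y y' c => by funext A; simp [mul_add])
    (fun r y c => by funext A; simp [mul_left_comm])
    (fun y c c' => by funext A; simp [add_mul])
    (fun r y c => by funext A; simp [mul_assoc])

theorem sigmaDual_apply (y : C4 n) (c : ℂ) (A : Fin 4 × Fin n) :
    sigmaDual σ y c A = c * (star (sigmaForm σ y (Pi.single (dualIndex A) 1))) := rfl

theorem isVertical_single_two (i : Fin n) (c : ℂ) : IsVertical (Pi.single (2, i) c : C4 n) :=
  fun j => by simp

theorem isVertical_single_three (i : Fin n) (c : ℂ) : IsVertical (Pi.single (3, i) c : C4 n) :=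
  fun j => by simp

theorem isVertical_sigmaDual (y : C4 n) (c : ℂ) : IsVertical (sigmaDual σ y c) := fun i => by
  constructor
  · rw [sigmaDual_apply, show dualIndex ((0 : Fin 4), i) = (2, i) from rfl,
      (isVertical_single_two i 1).sigmaForm_right, star_zero, mul_zero]
  · rw [sigmaDual_apply, show dualIndex ((1 : Fin 4), i) = (3, i) from rfl,
      (isVertical_single_three i 1).sigmaForm_right, star_zero, mul_zero]

theorem pairing_sigmaDual (y u : C4 n) (c : ℂ) :
    pairing (sigmaDual σ y c) u = (c * star (sigmaForm σ y u)).re := by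
  rw [pairing_apply, hermPairing, sigmaForm_eq_sum σ y u, star_sum, Finset.mul_sum,
    ← (Equiv.ofBijective _ dualIndex_involutive.bijective).sum_comp]
  congr 1
  refine Finset.sum_congr rfl fun A _ => ?_
  rw [Equiv.ofBijective_apply, sigmaDual_apply, dualIndex_involutive A, star_mul']
  ring

/-- The real inner product `Re (x * conj y)` of the complex numbers. -/
def reInner : ℂ →L[ℝ] ℂ →L[ℝ] ℝ :=
  LinearMap.toContinuousBilinearMap <| LinearMap.mk₂ ℝ (fun x y => (x * star y).re)
    (fun x x' y => by simp; ring) (fun c x y => by simp; ring)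
    (fun x y y' => by simp; ring) (fun c x y => by simp; ring)

theorem reInner_apply (x y : ℂ) : reInner x y = (x * star y).re := rfl

/-- The coefficients of the Kähler metric as a field of bilinear forms. -/
def metric (z : C4 n) : C4 n →L[ℝ] C4 n →L[ℝ] ℝ :=
  pairing + reInner.bilinearComp (sigmaForm σ z) (sigmaForm σ z)

theorem metric_apply (z v w : C4 n) : metric σ z v w
    = pairing v w + (sigmaForm σ z v * star (sigmaForm σ z w)).re := rfl

theorem sigmaPoly_hasFDerivAt (z : C4 n) :
    HasFDerivAt (sigmaPoly σ) (sigmaForm σ z) z := by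
  have h := ((sigmaForm σ).hasFDerivAt (x := z)).clm_apply (hasFDerivAt_id z)
  have h2 := h.const_mul (1 / 2 : ℂ)
  refine (h2.congr_of_eventuallyEq (.of_forall fun y => ?_)).congr_fderiv ?_
  · simp [sigmaPoly_eq]
  · ext v
    simp [sigmaForm_symm σ v z]
    ring

theorem kaehlerPotential_eq (z : C4 n) :
    kaehlerPotential σ z = pairing z z + ‖sigmaPoly σ z‖ ^ 2 := by
  rw [kaehlerPotential, pairing_apply, hermPairing_eq, Complex.re_sum, Complex.re_sum,
    Finset.mul_sum]
  congr 1
  refine Finset.sum_congr rfl fun i _ => ?_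
  simp
  ring

theorem kaehlerPotential_fderiv (z v : C4 n) :
    fderiv ℝ (fun x => (kaehlerPotential σ x : ℂ)) z v
      = ((2 * pairing z v + 2 * (sigmaPoly σ z * star (sigmaForm σ z v)).re : ℝ) : ℂ) := by
  have h1 := ((pairing (n := n)).hasFDerivAt (x := z)).clm_apply (hasFDerivAt_id z)
  have h2 := (sigmaPoly_hasFDerivAt σ z).norm_sq
  have h3 := h1.add h2
  have h4 := (Complex.ofRealCLM.hasFDerivAt (x := kaehlerPotential σ z)).comp z
    (h3.congr_of_eventuallyEq (f₁ := kaehlerPotential σ)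
      (.of_forall fun y => by simp [kaehlerPotential_eq]))
  rw [show (fun x => (kaehlerPotential σ x : ℂ)) = Complex.ofRealCLM ∘ kaehlerPotential σ from rfl,
    h4.fderiv]
  simp [pairing_symm v z, Complex.inner]
  ring

/-- The operator keeps the part of the differential that is antilinear in the direction. As
`sigmaPoly` is holomorphic, only its conjugate contributes to the derivative of `|σ(z)|²`. -/
theorem wirtingerBar_kaehlerPotential (B : Fin 4 × Fin n) (z : C4 n) :
    wirtingerBar B (fun x => (kaehlerPotential σ x : ℂ)) z
      = z (dualIndex B) + sigmaPoly σ z * star (sigmaForm σ z (Pi.single B 1)) := by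
  have hI : (Pi.single B Complex.I : C4 n) = Complex.I • Pi.single B 1 := by
    rw [← Pi.single_smul]; simp
  rw [wirtingerBar, kaehlerPotential_fderiv, kaehlerPotential_fderiv, hI, sigmaForm_smul_right,
    ← hI, pairing_symm, pairing_single, pairing_symm, pairing_single]
  apply Complex.ext <;> simp <;> ring

theorem hermCoeff_eq (A B : Fin 4 × Fin n) (z : C4 n) : hermCoeff σ A B z
    = (if dualIndex B = A then 1 else 0)
      + sigmaForm σ z (Pi.single A 1) * star (sigmaForm σ z (Pi.single B 1)) := by
  have hd (v : C4 n) : fderiv ℝ (wirtingerBar B (fun x => (kaehlerPotential σ x : ℂ))) z v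
      = v (dualIndex B) + (sigmaForm σ z v * star (sigmaForm σ z (Pi.single B 1))
        + sigmaPoly σ z * star (sigmaForm σ v (Pi.single B 1))) := by
    rw [show wirtingerBar B (fun x => (kaehlerPotential σ x : ℂ)) = _ from
      funext (wirtingerBar_kaehlerPotential σ B)]
    have h1 := (ContinuousLinearMap.proj (R := ℝ) (φ := fun _ : Fin 4 × Fin n => ℂ)
      (dualIndex B)).hasFDerivAt (x := z)
    have h2 := sigmaPoly_hasFDerivAt σ z
    have h3 := ((Complex.conjCLE : ℂ →L[ℝ] ℂ) ∘L
      ((sigmaForm σ).flip (Pi.single B 1))).hasFDerivAt (x := z)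
    refine (DFunLike.congr_fun (h1.add (h2.mul h3)).fderiv v).trans ?_
    simp
    ring
  have hI : (Pi.single A Complex.I : C4 n) = Complex.I • Pi.single A 1 := by
    rw [← Pi.single_smul]; simp
  -- Directions `1` and `i` agree on the part linear in the direction and cancel on the antilinear
  -- term with `sigmaPoly σ z`; both effects are `i² = -1`.
  have hI2 : Complex.I * Complex.I = -1 := Complex.I_mul_I
  rw [hermCoeff, wirtinger, hd, hd, hI, sigmaForm_smul_right, sigmaForm_smul_left]
  simp only [Pi.smul_apply, Pi.single_apply, smul_eq_mul, star_mul', Complex.star_def,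
    Complex.conj_I]
  linear_combination (-(1/2) * (if dualIndex B = A then (1 : ℂ) else 0)
    - (1/2) * sigmaForm σ z (Pi.single A 1)
      * (starRingEnd ℂ) (sigmaForm σ z (Pi.single B 1)) + (1/2) * sigmaPoly σ z *
      (starRingEnd ℂ) (sigmaForm σ (Pi.single A 1) (Pi.single B 1))) * hI2

/-- This replaces the definition by Wirtinger derivatives with the explicit form of the metric used
in all later computations. -/
theorem kaehlerMetric_eq (z v w : C4 n) : kaehlerMetric σ z v w = metric σ z v w := by
  rw [kaehlerMetric, metric_apply, pairing_apply, ← Complex.add_re]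
  congr 1
  simp only [hermCoeff_eq, add_mul, Finset.sum_add_distrib]
  congr 1
  · rw [Finset.sum_comm, ← (Equiv.ofBijective _ dualIndex_involutive.bijective).sum_comp]
    simp [hermPairing, dualIndex_involutive _]
  · rw [sigmaForm_eq_sum σ z v, sigmaForm_eq_sum σ z w, star_sum, Finset.sum_mul_sum]
    refine Finset.sum_congr rfl fun i _ => Finset.sum_congr rfl fun j _ => ?_
    rw [star_mul']
    ring

end MetricAlgebra

/-! ### Curvature of a metric conformal to the Kähler metric -/

namespace MetricCoord

open Filter Topology

variable {E : Type*} [NormedAddCommGroup E] [NormedSpace ℝ E]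

theorem fderiv_clm_apply₂ {F F' : Type*} [NormedAddCommGroup F] [NormedSpace ℝ F]
    [NormedAddCommGroup F'] [NormedSpace ℝ F'] {G : E → F →L[ℝ] F →L[ℝ] F'} {y : E}
    (hG : DifferentiableAt ℝ G y) (u : E) (v w : F) :
    fderiv ℝ G y u v w = fderiv ℝ (fun z => G z v w) y u := by
  have h := (hG.hasFDerivAt.clm_apply (hasFDerivAt_const v y)).clm_apply (hasFDerivAt_const w y)
  rw [h.fderiv]
  simp

/-- The geometric quantities at a point depend only on the germ of the coefficients. These
congruence lemmas later replace coefficients in a chart by an explicit conformal multiple of the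
Kähler metric. -/
theorem koszul_congr {G G' : E → E →L[ℝ] E →L[ℝ] ℝ} {y : E} (h : G =ᶠ[𝓝 y] G') :
    koszul G y = koszul G' y := by
  ext v w u
  simp only [koszul_apply, h.fderiv_eq]

theorem christoffel_congr {G G' : E → E →L[ℝ] E →L[ℝ] ℝ} {y : E} (h : G =ᶠ[𝓝 y] G') :
    christoffel G y = christoffel G' y := by
  simp only [christoffel, koszul_congr h, h.eq_of_nhds]

theorem curvature_congr {G G' : E → E →L[ℝ] E →L[ℝ] ℝ} {y : E} (h : G =ᶠ[𝓝 y] G') :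
    curvature G y = curvature G' y := by
  have h' : christoffel G =ᶠ[𝓝 y] christoffel G' :=
    h.eventually_nhds.mono fun _ hz => christoffel_congr hz
  ext w u v
  simp only [curvature, h'.fderiv_eq, h'.eq_of_nhds]

theorem ricci_congr {G G' : E → E →L[ℝ] E →L[ℝ] ℝ} {y : E} (h : G =ᶠ[𝓝 y] G') :
    ricci G y = ricci G' y := by
  ext w u
  simp only [ricci, curvature_congr h]

theorem weyl_congr [FiniteDimensional ℝ E] {G G' : E → E →L[ℝ] E →L[ℝ] ℝ} {y : E}
    (h : G =ᶠ[𝓝 y] G') : weyl G y = weyl G' y := by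
  ext v w u x
  simp only [weyl, scal, ricci_congr h, curvature_congr h, h.eq_of_nhds]

theorem isKaehlerAt_congr [NormedSpace ℂ E] {G G' : E → E →L[ℝ] E →L[ℝ] ℝ} {y : E}
    (h : G =ᶠ[𝓝 y] G') (hG : IsKaehlerAt G' y) : IsKaehlerAt G y := by
  rw [IsKaehlerAt, h.fderiv_eq, h.eq_of_nhds]
  exact hG

/-- In finite dimension an injective map to the dual is bijective by dimension. Invertibility must
be known because `inverse` is zero by convention otherwise. -/
theorem isInvertible_of_nondegenerate [FiniteDimensional ℝ E] {B : E →L[ℝ] E →L[ℝ] ℝ}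
    (hB : ∀ v, (∀ w, B v w = 0) → v = 0) : B.IsInvertible := by
  have hinj : Function.Injective (B : E →ₗ[ℝ] E →L[ℝ] ℝ) := by
    rw [injective_iff_map_eq_zero]
    exact fun v hv => hB v fun w => DFunLike.congr_fun hv w
  have hrank : Module.finrank ℝ E = Module.finrank ℝ (E →L[ℝ] ℝ) := by
    rw [← (LinearMap.toContinuousLinearMap (𝕜 := ℝ) (E := E) (F' := ℝ)).finrank_eq]
    exact (Subspace.dual_finrank_eq (K := ℝ) (V := E)).symm
  refine ⟨(LinearMap.linearEquivOfInjective _ hinj hrank).toContinuousLinearEquiv, ?_⟩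
  ext v w
  simp

/-- Christoffel symbols can thus be verified by pairing with the metric, without computing its
inverse. -/
theorem christoffel_eq_of_forall {G : E → E →L[ℝ] E →L[ℝ] ℝ} {y v w k : E}
    (hG : (G y).IsInvertible) (h : ∀ u, G y k u = koszul G y v w u) :
    christoffel G y v w = k := by
  rw [christoffel_apply, hG.inverse_apply_eq]
  ext u
  exact (h u).symm

end MetricCoord

section Curvature

open MetricCoord Filter Topology

variable {n : ℕ} (σ : Matrix (Fin n) (Fin n) ℂ)

/-! ### Nondegeneracy, derivatives and Hermitian symmetry of the explicit metric -/

theorem metric_symm (z v w : C4 n) : metric σ z v w = metric σ z w v := by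
  rw [metric_apply, metric_apply, pairing_symm]
  simp
  ring

theorem pairing_nondegenerate {v : C4 n} (h : ∀ w, pairing v w = 0) : v = 0 := by
  funext A
  have h1 := h (Pi.single (dualIndex A) 1)
  have h2 := h (Pi.single (dualIndex A) Complex.I)
  rw [pairing_symm, pairing_single, dualIndex_involutive A] at h1 h2
  apply Complex.ext <;> simp_all

/-- Testing against vertical vectors, on which the correction term vanishes, shows that `v` is
vertical. The correction then vanishes for every `w`, and nondegeneracy of the constant pairing
finishes. -/
theorem metric_nondegenerate (z : C4 n) {v : C4 n} (h : ∀ w, metric σ z v w = 0) : v = 0 := by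
  have hv : IsVertical v := fun i => by
    constructor
    · have h1 := h (Pi.single (2, i) 1)
      have h2 := h (Pi.single (2, i) Complex.I)
      rw [metric_apply, (isVertical_single_two i _).sigmaForm_right, pairing_symm,
        pairing_single, show dualIndex ((2 : Fin 4), i) = (0, i) from rfl] at h1 h2
      apply Complex.ext <;> simp_all
    · have h1 := h (Pi.single (3, i) 1)
      have h2 := h (Pi.single (3, i) Complex.I)
      rw [metric_apply, (isVertical_single_three i _).sigmaForm_right, pairing_symm,
        pairing_single, show dualIndex ((3 : Fin 4), i) = (1, i) from rfl] at h1 h2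
      apply Complex.ext <;> simp_all
  refine pairing_nondegenerate fun w => ?_
  have hw := h w
  rwa [metric_apply, hv.sigmaForm_right, zero_mul, Complex.zero_re, add_zero] at hw

theorem metric_isInvertible (z : C4 n) : (metric σ z).IsInvertible :=
  isInvertible_of_nondegenerate fun _ => metric_nondegenerate σ z

theorem contDiff_metric : ContDiff ℝ ∞ (metric σ) := by
  rw [contDiff_clm_apply_iff]
  intro v
  rw [contDiff_clm_apply_iff]
  intro w
  have h (v : C4 n) : ContDiff ℝ ∞ fun z => sigmaForm σ z v :=
    ((sigmaForm σ).flip v).contDiff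
  exact contDiff_const.add ((reInner.contDiff.comp (h v)).clm_apply (h w))

theorem metric_fderiv (y u v w : C4 n) : fderiv ℝ (metric σ) y u v w =
    (sigmaForm σ u v * star (sigmaForm σ y w) + sigmaForm σ y v * star (sigmaForm σ u w)).re := by
  rw [fderiv_clm_apply₂ ((contDiff_metric σ).differentiable (by simp) y)]
  have h (v : C4 n) : HasFDerivAt (fun z => sigmaForm σ z v) ((sigmaForm σ).flip v) y :=
    ((sigmaForm σ).flip v).hasFDerivAt
  have h1 := ((reInner.hasFDerivAt.comp y (h v)).clm_apply (h w)).const_add (pairing v w)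
  refine (DFunLike.congr_fun h1.fderiv u).trans ?_
  simp [reInner_apply]
  ring

/-- A vertical vector does not see the correction term, so its dual for the constant pairing is also
its dual for the metric at any point. -/
theorem metric_sigmaDual (y z u : C4 n) (c : ℂ) :
    metric σ y (sigmaDual σ z c) u = (c * star (sigmaForm σ z u)).re := by
  rw [metric_apply, (isVertical_sigmaDual σ z c).sigmaForm_right, zero_mul, Complex.zero_re,
    add_zero, pairing_sigmaDual]

theorem metric_smul_I (y v w : C4 n) :
    metric σ y (Complex.I • v) (Complex.I • w) = metric σ y v w := by
  rw [metric_apply, metric_apply, sigmaForm_smul_right, sigmaForm_smul_right, pairing_apply,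
    pairing_apply]
  congr 2
  · simp only [hermPairing, Pi.smul_apply, smul_eq_mul, star_mul', Complex.star_def,
      Complex.conj_I]
    refine Finset.sum_congr rfl fun A _ => ?_
    linear_combination (-(v A * (starRingEnd ℂ) (w (dualIndex A)))) * Complex.I_mul_I
  · simp only [star_mul', Complex.star_def, Complex.conj_I]
    linear_combination (-(sigmaForm σ y v * (starRingEnd ℂ) (sigmaForm σ y w))) * Complex.I_mul_I

/-! ### Christoffel symbols of conformal multiples -/

/-- The metric `e^{2h} g`. -/
def confMetric (h : C4 n → ℝ) (y : C4 n) : C4 n →L[ℝ] C4 n →L[ℝ] ℝ :=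
  Real.exp (2 * h y) • metric σ y

theorem confMetric_isInvertible (h : C4 n → ℝ) (y : C4 n) : (confMetric σ h y).IsInvertible := by
  refine isInvertible_of_nondegenerate fun v hv => metric_nondegenerate σ y fun w => ?_
  simpa [confMetric] using hv w

variable {σ} in
theorem contDiffOn_confMetric {h : C4 n → ℝ} {U : Set (C4 n)} (hh : ContDiffOn ℝ ∞ h U) :
    ContDiffOn ℝ ∞ (confMetric σ h) U :=
  (contDiffOn_const.mul hh).exp.smul (contDiff_metric σ).contDiffOn

variable {σ} in
theorem confMetric_fderiv {h : C4 n → ℝ} {y : C4 n} (hh : DifferentiableAt ℝ h y)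
    (u v w : C4 n) : fderiv ℝ (confMetric σ h) y u v w
      = Real.exp (2 * h y) * (fderiv ℝ (metric σ) y u v w + 2 * fderiv ℝ h y u * metric σ y v w) := by
  have h1 := (hh.hasFDerivAt.const_mul 2).exp.smul
    ((contDiff_metric σ).differentiable (by simp) y).hasFDerivAt
  refine (DFunLike.congr_fun (DFunLike.congr_fun (DFunLike.congr_fun h1.fderiv u) v) w).trans ?_
  simp
  ring

variable {σ} in
-- For `g` itself, conjugate products have equal real parts, so in the alternating sum of
-- derivatives all terms cancel except two equal ones, `B(v,w) conj B(y,u)`. The remaining terms are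
-- the usual ones of a conformal change.
theorem confMetric_koszul {h : C4 n → ℝ} {y : C4 n} (hh : DifferentiableAt ℝ h y)
    (v w u : C4 n) : koszul (confMetric σ h) y v w u
      = Real.exp (2 * h y) * ((sigmaForm σ v w * star (sigmaForm σ y u)).re
        + fderiv ℝ h y v * metric σ y w u + fderiv ℝ h y w * metric σ y v u
        - fderiv ℝ h y u * metric σ y v w) := by
  rw [koszul_apply, confMetric_fderiv hh, confMetric_fderiv hh, confMetric_fderiv hh,
    metric_fderiv, metric_fderiv, metric_fderiv, sigmaForm_symm σ w v, sigmaForm_symm σ u v,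
    sigmaForm_symm σ w u]
  simp
  ring

variable {σ} in
theorem confMetric_christoffel {h : C4 n → ℝ} {y : C4 n} (hh : DifferentiableAt ℝ h y)
    (v w : C4 n) : christoffel (confMetric σ h) y v w
      = sigmaDual σ y (sigmaForm σ v w) + fderiv ℝ h y v • w + fderiv ℝ h y w • v
        - metric σ y v w • (metric σ y).inverse (fderiv ℝ h y) := by
  refine christoffel_eq_of_forall (confMetric_isInvertible σ h y) fun u => ?_
  rw [confMetric_koszul hh]
  simp [confMetric, metric_sigmaDual, (metric_isInvertible σ y).self_apply_inverse]
  ring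

theorem contDiff_metric_inverse : ContDiff ℝ ∞ fun z => (metric σ z).inverse := by
  rw [contDiff_iff_contDiffAt]
  intro z
  exact (metric_isInvertible σ z).contDiffAt_map_inverse.comp z (contDiff_metric σ).contDiffAt

theorem contDiffOn_confMetric_christoffel {h : C4 n → ℝ} {U : Set (C4 n)} (hU : IsOpen U)
    (hh : ContDiffOn ℝ ∞ h U) : ContDiffOn ℝ ∞ (christoffel (confMetric σ h)) U := by
  rw [contDiffOn_clm_apply]
  intro v
  rw [contDiffOn_clm_apply]
  intro w
  have hd : ContDiffOn ℝ ∞ (fderiv ℝ h) U := hh.fderiv_of_isOpen hU (by simp)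
  have hm : ContDiffOn ℝ ∞ (fun z => metric σ z v w) U :=
    (((contDiff_metric σ).clm_apply contDiff_const).clm_apply contDiff_const).contDiffOn
  have hs : ContDiffOn ℝ ∞ (fun z => sigmaDual σ z (sigmaForm σ v w)) U :=
    ((sigmaDual σ).flip (sigmaForm σ v w)).contDiff.contDiffOn
  refine ContDiffOn.congr (f := fun y => sigmaDual σ y (sigmaForm σ v w) + fderiv ℝ h y v • w
    + fderiv ℝ h y w • v - metric σ y v w • (metric σ y).inverse (fderiv ℝ h y)) ?_
    fun z hz => confMetric_christoffel
      ((hh.contDiffAt (hU.mem_nhds hz)).differentiableAt (by simp)) v w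
  exact ((hs.add ((hd.clm_apply contDiffOn_const).smul contDiffOn_const)).add
    ((hd.clm_apply contDiffOn_const).smul contDiffOn_const)).sub
    (hm.smul ((contDiff_metric_inverse σ).contDiffOn.clm_apply hd))

/-! ### Homothetic metrics are Ricci-flat and Kähler -/

theorem confMetric_const_christoffel (c : ℝ) (y v w : C4 n) :
    christoffel (confMetric σ fun _ => c) y v w = sigmaDual σ y (sigmaForm σ v w) := by
  rw [confMetric_christoffel (differentiableAt_const c)]
  simp

/-- The Christoffel symbols are linear in the point and take vertical values. Inserting one into
another gives zero, since `sigmaForm` kills vertical vectors, and only the constant derivative terms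
remain. -/
theorem confMetric_const_curvature (c : ℝ) (y v w u : C4 n) :
    curvature (confMetric σ fun _ => c) y w u v
      = sigmaDual σ v (sigmaForm σ w u) - sigmaDual σ w (sigmaForm σ v u) := by
  have hd : DifferentiableAt ℝ (christoffel (confMetric σ fun _ => c)) y :=
    ((contDiffOn_confMetric_christoffel σ isOpen_univ contDiffOn_const).contDiffAt
      univ_mem).differentiableAt (by simp)
  have h (v w u : C4 n) : fderiv ℝ (christoffel (confMetric σ fun _ => c)) y v w u
      = sigmaDual σ v (sigmaForm σ w u) := by
    rw [fderiv_clm_apply₂ hd]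
    simp only [confMetric_const_christoffel]
    exact DFunLike.congr_fun ((sigmaDual σ).flip (sigmaForm σ w u)).fderiv v
  simp only [curvature, LinearMap.coe_mk, AddHom.coe_mk, h, confMetric_const_christoffel,
    (isVertical_sigmaDual σ _ _).sigmaForm_right, map_zero, add_zero, sub_zero]

theorem IsVertical.sub {v w : C4 n} (hv : IsVertical v) (hw : IsVertical w) :
    IsVertical (v - w) := fun i => by simp [hv i, hw i]

/-- The map `v ↦ R(v,w)u` has vertical image and vanishes on vertical vectors; being nilpotent of
order two, it is traceless. -/
theorem confMetric_const_ricci (c : ℝ) (y w u : C4 n) :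
    ricci (confMetric σ fun _ => c) y w u = 0 := by
  have hv (v : C4 n) : IsVertical (curvature (confMetric σ fun _ => c) y w u v) := by
    rw [confMetric_const_curvature]
    exact (isVertical_sigmaDual σ _ _).sub (isVertical_sigmaDual σ _ _)
  have hk {v : C4 n} (hv : IsVertical v) : curvature (confMetric σ fun _ => c) y w u v = 0 := by
    rw [confMetric_const_curvature, hv.sigmaForm_left, map_zero, sub_zero]
    funext A
    rw [sigmaDual_apply, hv.sigmaForm_left]
    simp
  refine (LinearMap.isNilpotent_trace_of_isNilpotent ⟨2, ?_⟩).eq_zero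
  rw [pow_two]
  exact LinearMap.ext fun v => hk (hv v)

theorem confMetric_const_isKaehlerAt (c : ℝ) (y : C4 n) :
    IsKaehlerAt (confMetric σ fun _ => c) y := by
  constructor
  · intro v w
    simp [confMetric, metric_smul_I]
  · intro u v w
    rw [confMetric_fderiv (differentiableAt_const c), confMetric_fderiv (differentiableAt_const c),
      confMetric_fderiv (differentiableAt_const c)]
    -- The six terms cancel in pairs, because `Re (i X conj Y) = - Re (i Y conj X)`.
    simp only [metric_fderiv, sigmaForm_smul_right, fderiv_fun_const, Pi.zero_apply,
      zero_apply, mul_zero, zero_mul, add_zero, sigmaForm_symm σ v u,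
      sigmaForm_symm σ w u, sigmaForm_symm σ w v]
    simp
    ring

/-! ### The Weyl tensor -/

variable {σ} in
theorem IsVertical.sigmaDual {y : C4 n} (hy : IsVertical y) (c : ℂ) : sigmaDual σ y c = 0 := by
  funext A
  rw [sigmaDual_apply, hy.sigmaForm_left]
  simp

theorem isHorizontal_single_zero (i : Fin n) (c : ℂ) : IsHorizontal (Pi.single (0, i) c : C4 n) :=
  fun j => by simp

theorem isHorizontal_single_one (i : Fin n) (c : ℂ) : IsHorizontal (Pi.single (1, i) c : C4 n) :=
  fun j => by simp

theorem IsHorizontal.smul_add_smul {v w : C4 n} (hv : IsHorizontal v) (hw : IsHorizontal w)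
    (r s : ℝ) : IsHorizontal (r • v + s • w) := fun i => by simp [hv i, hw i]

theorem IsHorizontal.smul {v : C4 n} (hv : IsHorizontal v) (c : ℂ) : IsHorizontal (c • v) :=
  fun i => by simp [hv i]

variable {σ} in
theorem metric_of_isVertical {y : C4 n} (hy : IsVertical y) (v w : C4 n) :
    metric σ y v w = pairing v w := by
  rw [metric_apply, hy.sigmaForm_left, zero_mul, Complex.zero_re, add_zero]

variable {σ} in
-- At a vertical point the metric is the constant pairing, for which horizontal vectors are mutually
-- orthogonal. Every term involving the derivatives of `h` therefore disappears after pairing with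
-- the horizontal `x`.
theorem confMetric_curvature_of_isHorizontal {h : C4 n → ℝ} {U : Set (C4 n)} (hU : IsOpen U)
    (hh : ContDiffOn ℝ ∞ h U) {y : C4 n} (hyU : y ∈ U) (hy : IsVertical y) {v w u x : C4 n}
    (hv : IsHorizontal v) (hw : IsHorizontal w) (hu : IsHorizontal u) (hx : IsHorizontal x) :
    metric σ y (curvature (confMetric σ h) y w u v) x
      = (sigmaForm σ w u * star (sigmaForm σ v x) - sigmaForm σ v u * star (sigmaForm σ w x)).re := by
  have hUy := hU.mem_nhds hyU
  have hd : DifferentiableAt ℝ (christoffel (confMetric σ h)) y :=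
    ((contDiffOn_confMetric_christoffel σ hU hh).contDiffAt hUy).differentiableAt (by simp)
  have hh' : DifferentiableAt ℝ h y := (hh.contDiffAt hUy).differentiableAt (by simp)
  have hdh : DifferentiableAt ℝ (fderiv ℝ h) y :=
    ((hh.fderiv_of_isOpen hU (m := ∞) (by simp)).contDiffAt hUy).differentiableAt (by simp)
  have hgrad : DifferentiableAt ℝ (fun z => (metric σ z).inverse (fderiv ℝ h z)) y :=
    ((contDiff_metric_inverse σ).differentiable (by simp) y).clm_apply hdh
  have hp {a b : C4 n} (ha : IsHorizontal a) (hb : IsHorizontal b) : metric σ y a b = 0 := by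
    rw [metric_of_isVertical hy, ha.pairing hb]
  have h1 {v w u : C4 n} (hv : IsHorizontal v) (hw : IsHorizontal w) (hu : IsHorizontal u) :
      metric σ y (fderiv ℝ (christoffel (confMetric σ h)) y v w u) x
        = (sigmaForm σ w u * star (sigmaForm σ v x)).re := by
    have hm : HasFDerivAt (fun z => metric σ z w u)
        (fderiv ℝ (fun z => metric σ z w u) y) y :=
      ((((contDiff_metric σ).clm_apply contDiff_const).clm_apply
        contDiff_const).differentiable (by simp) y).hasFDerivAt
    have hD (a : C4 n) : HasFDerivAt (fun z => fderiv ℝ h z a)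
        ((fderiv ℝ (fderiv ℝ h) y).flip a) y := by
      convert! hdh.hasFDerivAt.clm_apply (hasFDerivAt_const a y) using 1
      ext; simp
    have hf := (((((sigmaDual σ).flip (sigmaForm σ w u)).hasFDerivAt (x := y)).add
      ((hD w).smul_const u)).add ((hD u).smul_const w)).sub (hm.smul hgrad.hasFDerivAt)
    have he : (fun z => christoffel (confMetric σ h) z w u) =ᶠ[𝓝 y]
        (fun z => sigmaDual σ z (sigmaForm σ w u) + fderiv ℝ h z w • u
          + fderiv ℝ h z u • w - metric σ z w u • (metric σ z).inverse (fderiv ℝ h z)) := by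
      filter_upwards [hUy] with z hz
      exact confMetric_christoffel ((hh.contDiffAt (hU.mem_nhds hz)).differentiableAt (by simp)) w u
    -- The correction is quadratic in `B(z, ·)`, which vanishes at the vertical point `y`, so its
    -- first derivative vanishes there. Together with `metric σ y w u = 0` this removes the gradient
    -- term.
    have hmz : fderiv ℝ (fun z => metric σ z w u) y v = 0 := by
      rw [← fderiv_clm_apply₂ ((contDiff_metric σ).differentiable (by simp) y), metric_fderiv,
        hy.sigmaForm_left, hy.sigmaForm_left]
      simp
    rw [fderiv_clm_apply₂ hd, he.fderiv_eq]
    refine (congrArg (fun k => metric σ y k x) (DFunLike.congr_fun hf.fderiv v)).trans ?_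
    simp [hmz, hp hw hu, hp hu hx, hp hw hx, metric_sigmaDual]
  have h2 {v w u : C4 n} (hv : IsHorizontal v) (hw : IsHorizontal w) (hu : IsHorizontal u) :
      metric σ y (christoffel (confMetric σ h) y v (christoffel (confMetric σ h) y w u)) x = 0 := by
    -- On horizontal vectors the Christoffel symbols at `y` are again horizontal, so iterated ones
    -- remain orthogonal to `x`.
    have h3 {a b : C4 n} (ha : IsHorizontal a) (hb : IsHorizontal b) :
        christoffel (confMetric σ h) y a b = fderiv ℝ h y a • b + fderiv ℝ h y b • a := by
      rw [confMetric_christoffel hh', hy.sigmaDual, hp ha hb]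
      simp
    have hk := hu.smul_add_smul hw (fderiv ℝ h y w) (fderiv ℝ h y u)
    rw [h3 hw hu, h3 hv hk]
    exact hp (hk.smul_add_smul hv _ _) hx
  simp only [curvature, LinearMap.coe_mk, AddHom.coe_mk, map_add, map_sub,
    add_apply, sub_apply, h1 hv hw hu, h1 hw hv hu,
    h2 hv hw hu, h2 hw hv hu, Complex.sub_re]
  ring

variable {σ} in
theorem confMetric_exists_weyl_ne_zero (hσ : σ ≠ 0) {h : C4 n → ℝ} {U : Set (C4 n)}
    (hU : IsOpen U) (hh : ContDiffOn ℝ ∞ h U) {y : C4 n} (hyU : y ∈ U) (hy : IsVertical y) :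
    ∃ v w u x, weyl (confMetric σ h) y v w u x ≠ 0 := by
  obtain ⟨i, j, hij⟩ : ∃ i j, σ i j ≠ 0 := by
    by_contra! hc
    exact hσ (by ext i j; exact hc i j)
  set w : C4 n := Pi.single (0, i) 1 with hw_def
  set u : C4 n := Pi.single (1, j) 1 with hu_def
  have hw : IsHorizontal w := isHorizontal_single_zero i 1
  have hu : IsHorizontal u := isHorizontal_single_one j 1
  have hB : sigmaForm σ w u = σ i j := by
    simp [sigmaForm_apply, hw_def, hu_def, Pi.single_apply, Prod.ext_iff]
  have hv := hw.smul Complex.I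
  have hx := hu.smul Complex.I
  -- With the factors `i` the two products in the curvature add up, to `-2 |σ_ij|²`; with `v = w`
  -- they would cancel.
  refine ⟨Complex.I • w, w, u, Complex.I • u, fun h0 => hij ?_⟩
  have hp {a b : C4 n} (ha : IsHorizontal a) (hb : IsHorizontal b) :
      confMetric σ h y a b = 0 := by
    simp [confMetric, metric_of_isVertical hy, ha.pairing hb]
  -- Each Ricci or scalar term has a factor that is the metric on two horizontal vectors.
  simp only [weyl, hp hv hx, hp hw hx, hp hw hu, hp hv hu, mul_zero, zero_mul, sub_zero,
    add_zero] at h0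
  have h1 : metric σ y (curvature (confMetric σ h) y w u (Complex.I • w)) (Complex.I • u) = 0 := by
    simpa [confMetric] using h0
  rw [confMetric_curvature_of_isHorizontal hU hh hyU hy hv hw hu hx, sigmaForm_smul_right,
    sigmaForm_smul_right, sigmaForm_smul_left, hB] at h1
  have h2 : Complex.normSq (σ i j) = 0 := by
    simp at h1
    rw [Complex.normSq_apply]
    linarith
  exact Complex.normSq_eq_zero.1 h2

/-! ### The signature -/

/-- A linear transformation that carries the metric at `y` to the constant pairing. -/
def shear (y v : C4 n) : C4 n := v - (1 / 2 : ℝ) • sigmaDual σ y (sigmaForm σ y v)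

/-- The two cross terms, each with coefficient one half, together cancel the correction. The term
quadratic in the shift vanishes because the shift is vertical and vertical vectors are null. -/
theorem metric_shear (y v w : C4 n) :
    metric σ y (shear σ y v) (shear σ y w) = pairing v w := by
  have h (v w : C4 n) : metric σ y v (sigmaDual σ y (sigmaForm σ y w))
      = (sigmaForm σ y v * star (sigmaForm σ y w)).re := by
    rw [metric_symm, metric_sigmaDual]
    simp
    ring
  simp only [shear, map_sub, map_smul, sub_apply, smul_apply, h,
    metric_sigmaDual, (isVertical_sigmaDual σ _ _).sigmaForm_right, metric_apply σ y v w]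
  simp
  ring

/-- An orthogonal family for the constant pairing. -/
def pairingFrame (s : ℝ) (m : Fin 2 × Fin n × Fin 2) : C4 n :=
  let c : ℂ := if m.2.2 = 0 then 1 else Complex.I
  (Pi.single (Fin.castAdd 2 m.1, m.2.1) c : C4 n)
    + s • (Pi.single (Fin.natAdd 2 m.1, m.2.1) c : C4 n)

/-- The parameters `1` and `-1` give vectors of square `2` and `-2`, and the two families are
orthogonal to each other. -/
theorem pairing_pairingFrame (s t : ℝ) (m m' : Fin 2 × Fin n × Fin 2) :
    pairing (pairingFrame s m) (pairingFrame t m') = if m = m' then s + t else 0 := by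
  have hd (k : Fin 2) (i : Fin n) :
      dualIndex (Fin.castAdd 2 k, i) = (Fin.natAdd 2 k, i) ∧
      dualIndex (Fin.natAdd 2 k, i) = (Fin.castAdd 2 k, i) := by
    fin_cases k <;> exact ⟨rfl, rfl⟩
  have hne (k k' : Fin 2) : Fin.castAdd 2 k ≠ Fin.natAdd 2 k' := by
    revert k k'; decide
  have hne' (k k' : Fin 2) : Fin.natAdd 2 k' ≠ Fin.castAdd 2 k := (hne k k').symm
  obtain ⟨k, i, l⟩ := m
  obtain ⟨k', i', l'⟩ := m'
  simp only [pairingFrame, map_add, map_smul, add_apply, smul_apply, pairing_single, hd,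
    Pi.single_apply, Prod.mk.injEq, hne, hne', false_and,
    if_false, (Fin.castAdd_injective 2 2).eq_iff, Fin.natAdd_inj]
  by_cases hk : k = k' <;> by_cases hi : i = i' <;> simp [hk, hi]
  fin_cases l <;> fin_cases l' <;> simp

theorem finrank_C4 : Module.finrank ℝ (C4 n) = 8 * n := by
  simp [Module.finrank_pi_fintype, Complex.finrank_real_complex]
  ring

theorem exists_orthonormal_basis [NeZero n] (c : ℝ) (hc : 0 < c) (y : C4 n) :
    ∃ b : Module.Basis (Fin (4 * n) ⊕ Fin (4 * n)) ℝ (C4 n), ∀ i j,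
      c * metric σ y (b i) (b j) = if i = j then Sum.elim (fun _ => 1) (fun _ => -1) i else 0 := by
  let e : Fin (4 * n) ≃ Fin 2 × Fin n × Fin 2 := Fintype.equivOfCardEq (by simp; ring)
  -- Normalizes the squares `±2` of the frame to `±1` for `c` times the metric.
  let r : ℝ := (Real.sqrt (2 * c))⁻¹
  have hr : c * (r * r) = 1 / 2 := by
    have : r * r = (2 * c)⁻¹ := by
      rw [← mul_inv, Real.mul_self_sqrt (by positivity)]
    rw [this]
    field_simp
  let f : Fin (4 * n) ⊕ Fin (4 * n) → C4 n :=
    fun i => shear σ y (r • i.elim (fun j => pairingFrame 1 (e j)) fun j => pairingFrame (-1) (e j))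
  have hf (i j) : c * metric σ y (f i) (f j)
      = if i = j then Sum.elim (fun _ => 1) (fun _ => -1) i else 0 := by
    simp only [f, metric_shear, map_smul, smul_apply, smul_eq_mul]
    rw [← mul_assoc r r, ← mul_assoc c, hr]
    rcases i with i | i <;> rcases j with j | j <;>
      simp [pairing_pairingFrame, e.injective.eq_iff]
    · split_ifs <;> norm_num
    · split_ifs <;> norm_num
  have hli : LinearIndependent ℝ f := by
    rw [Fintype.linearIndependent_iff]
    intro g hg i
    have h0 : c * metric σ y (∑ j, g j • f j) (f i) = 0 := by rw [hg]; simp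
    simp only [map_sum, map_smul, sum_apply, smul_apply,
      smul_eq_mul, Finset.mul_sum, mul_left_comm c, hf] at h0
    rcases i with i | i <;> simpa using h0
  have : Nonempty (Fin (4 * n) ⊕ Fin (4 * n)) :=
    ⟨Sum.inl ⟨0, Nat.mul_pos four_pos (NeZero.pos n)⟩⟩
  refine ⟨basisOfLinearIndependentOfCardEqFinrank hli ?_, fun i j => ?_⟩
  · rw [finrank_C4]
    simp
    ring
  · simpa using hf i j

end Curvature

/-! ### The diagonal flow and its time function -/

section Flow

open Filter Topology

variable {n : ℕ}

theorem weight_add (a b a' b' : ℝ) (k : Fin 4) :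
    weight (a + a') (b + b') k = weight a b k + weight a' b' k := by
  fin_cases k <;> simp [weight] <;> ring

theorem weight_mul (t a b : ℝ) (k : Fin 4) : weight (t * a) (t * b) k = t * weight a b k := by
  fin_cases k <;> simp [weight] <;> ring

theorem weight_pos {a b : ℝ} (ha : 0 < a) (hb : 0 < b) (k : Fin 4) : 0 < weight a b k := by
  fin_cases k <;> simp [weight] <;> positivity

/-- Explains the weights `a+2b` and `2a+b`: the constant pairing scales with factor `e^{2(a+b)}`,
just as `|B|²` does, since `B` pairs the blocks of weights `a` and `b`. -/
theorem weight_dual (a b : ℝ) (A : Fin 4 × Fin n) :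
    weight a b A.1 + weight a b (dualIndex A).1 = 2 * (a + b) := by
  obtain ⟨k, i⟩ := A
  fin_cases k <;> simp [weight, dualIndex] <;> ring

theorem phiLin_phiLin (a b a' b' : ℝ) (z : C4 n) :
    phiLin a b (phiLin a' b' z) = phiLin (a + a') (b + b') z := by
  funext A
  rw [phiLin_apply, phiLin_apply, phiLin_apply, weight_add, Real.exp_add, Complex.ofReal_mul,
    mul_assoc]

theorem phiLin_zero (z : C4 n) : phiLin 0 0 z = z := by
  funext A
  have h : weight 0 0 A.1 = 0 := by simpa using weight_mul 0 0 0 A.1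
  simp [phiLin_apply, h]

theorem phiLin_ne_zero (a b : ℝ) {z : C4 n} (hz : z ≠ 0) : phiLin a b z ≠ 0 :=
  phiLin_mem a b ⟨z, hz⟩

theorem metric_phiLin (σ : Matrix (Fin n) (Fin n) ℂ) (a b : ℝ) (z v w : C4 n) :
    metric σ (phiLin a b z) (phiLin a b v) (phiLin a b w)
      = Real.exp (2 * (a + b)) * metric σ z v w := by
  have hB (v w : C4 n) : sigmaForm σ (phiLin a b v) (phiLin a b w)
      = (Real.exp (a + b) : ℂ) * sigmaForm σ v w := by
    simp only [sigmaForm_apply, Finset.mul_sum, phiLin_apply]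
    refine Finset.sum_congr rfl fun i _ => Finset.sum_congr rfl fun j _ => ?_
    simp [weight, Complex.exp_add]
    ring
  have hP : pairing (phiLin a b v) (phiLin a b w) = Real.exp (2 * (a + b)) * pairing v w := by
    rw [pairing_apply, pairing_apply, ← Complex.re_ofReal_mul, hermPairing, hermPairing,
      Finset.mul_sum]
    congr 1
    refine Finset.sum_congr rfl fun A _ => ?_
    rw [phiLin_apply, phiLin_apply, ← weight_dual a b A, Real.exp_add, star_mul',
      Complex.star_def, Complex.conj_ofReal]
    push_cast
    ring
  rw [metric_apply, metric_apply, hB, hB, hP, mul_add (Real.exp _), ← Complex.re_ofReal_mul, star_mul',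
    Complex.star_def, Complex.conj_ofReal, two_mul, Real.exp_add, Complex.ofReal_mul]
  congr 2
  ring

/-- The square of the Euclidean norm of `φ_{-ta,-tb} z`. -/
def flowNorm (a b : ℝ) (z : C4 n) (t : ℝ) : ℝ :=
  ∑ A, Real.exp (-(2 * weight a b A.1 * t)) * ‖z A‖ ^ 2

theorem flowNorm_phiLin (a b s : ℝ) (z : C4 n) (t : ℝ) :
    flowNorm a b (phiLin (s * a) (s * b) z) t = flowNorm a b z (t - s) := by
  refine Finset.sum_congr rfl fun A _ => ?_
  rw [phiLin_apply, norm_mul, mul_pow, ← mul_assoc, Complex.norm_real, Real.norm_eq_abs,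
    Real.abs_exp, ← Real.exp_nat_mul, ← Real.exp_add, weight_mul]
  congr 2
  push_cast
  ring

theorem contDiff_flowNorm (a b : ℝ) :
    ContDiff ℝ ∞ fun p : C4 n × ℝ => flowNorm a b p.1 p.2 := by
  refine ContDiff.sum fun A _ => ContDiff.mul (by fun_prop) ?_
  exact ((ContinuousLinearMap.proj (R := ℝ) (φ := fun _ : Fin 4 × Fin n => ℂ) A).contDiff.comp
    contDiff_fst).norm_sq ℝ

theorem hasDerivAt_flowNorm (a b : ℝ) (z : C4 n) (t : ℝ) : HasDerivAt (flowNorm a b z)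
    (∑ A, -(2 * weight a b A.1 * (Real.exp (-(2 * weight a b A.1 * t)) * ‖z A‖ ^ 2))) t := by
  refine HasDerivAt.fun_sum fun A _ => ?_
  have h := ((((hasDerivAt_id t).const_mul (2 * weight a b A.1)).neg).exp).mul_const (‖z A‖ ^ 2)
  refine h.congr_deriv ?_
  simp
  ring

theorem flowNorm_deriv_neg {a b : ℝ} (ha : 0 < a) (hb : 0 < b) {z : C4 n} (hz : z ≠ 0) (t : ℝ) :
    ∑ A, -(2 * weight a b A.1 * (Real.exp (-(2 * weight a b A.1 * t)) * ‖z A‖ ^ 2)) < 0 := by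
  obtain ⟨A, hA⟩ := Function.ne_iff.1 hz
  refine Finset.sum_neg' (fun B _ => ?_) ⟨A, Finset.mem_univ A, ?_⟩
  · have := weight_pos ha hb B.1
    exact neg_nonpos.2 (by positivity)
  · have := weight_pos ha hb A.1
    have hA' : 0 < ‖z A‖ := norm_pos_iff.2 hA
    exact neg_neg_of_pos (by positivity)

theorem flowNorm_strictAnti {a b : ℝ} (ha : 0 < a) (hb : 0 < b) {z : C4 n} (hz : z ≠ 0) :
    StrictAnti (flowNorm a b z) :=
  strictAnti_of_deriv_neg fun t => by
    rw [(hasDerivAt_flowNorm a b z t).deriv]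
    exact flowNorm_deriv_neg ha hb hz t

theorem exists_flowNorm_eq_one {a b : ℝ} (ha : 0 < a) (hb : 0 < b) {z : C4 n} (hz : z ≠ 0) :
    ∃ t, flowNorm a b z t = 1 := by
  have hc : Continuous (flowNorm a b z) :=
    continuous_iff_continuousAt.2 fun t => (hasDerivAt_flowNorm a b z t).continuousAt
  have h0 : Tendsto (flowNorm a b z) atTop (𝓝 0) := by
    rw [show (0 : ℝ) = ∑ A : Fin 4 × Fin n, 0 * ‖z A‖ ^ 2 by simp]
    refine tendsto_finsetSum _ fun A _ => Tendsto.mul_const _ ?_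
    refine Real.tendsto_exp_neg_atTop_nhds_zero.comp ?_
    exact tendsto_id.const_mul_atTop (by have := weight_pos ha hb A.1; positivity)
  obtain ⟨A, hA⟩ := Function.ne_iff.1 hz
  have hA' : 0 < ‖z A‖ := norm_pos_iff.2 hA
  have hw := weight_pos ha hb A.1
  -- The sum tends to zero in the future. In the past a single nonzero coordinate suffices: at the
  -- time given here its own term equals one.
  refine mem_range_of_exists_le_of_exists_ge hc ?_
    ⟨Real.log (‖z A‖ ^ 2) / (2 * weight a b A.1), ?_⟩
  · exact ((h0.eventually (ge_mem_nhds one_pos))).exists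
  · refine le_trans (le_of_eq ?_) (Finset.single_le_sum (fun B _ => by positivity)
      (Finset.mem_univ A))
    rw [mul_div_cancel₀ _ (by positivity), Real.exp_neg, Real.exp_log (by positivity),
      inv_mul_cancel₀ (by positivity)]

/-- The time at which the flow through a point of the Euclidean unit sphere reaches `z`. -/
def timeFn (a b : ℝ) (z : C4 n) : ℝ := Classical.epsilon fun t => flowNorm a b z t = 1

theorem flowNorm_timeFn {a b : ℝ} (ha : 0 < a) (hb : 0 < b) {z : C4 n} (hz : z ≠ 0) :
    flowNorm a b z (timeFn a b z) = 1 :=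
  Classical.epsilon_spec (exists_flowNorm_eq_one ha hb hz)

theorem timeFn_eq {a b : ℝ} (ha : 0 < a) (hb : 0 < b) {z : C4 n} (hz : z ≠ 0) {t : ℝ}
    (ht : flowNorm a b z t = 1) :
    timeFn a b z = t :=
  (flowNorm_strictAnti ha hb hz).injective ((flowNorm_timeFn ha hb hz).trans ht.symm)

theorem timeFn_phiLin {a b : ℝ} (ha : 0 < a) (hb : 0 < b) {z : C4 n} (hz : z ≠ 0) (s : ℝ) :
    timeFn a b (phiLin (s * a) (s * b) z) = timeFn a b z + s := by
  refine timeFn_eq ha hb (phiLin_ne_zero _ _ hz) ?_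
  rw [flowNorm_phiLin, add_sub_cancel_right, flowNorm_timeFn ha hb hz]

/-- The derivative of `flowNorm` in time is strictly negative, so the implicit function theorem
applies; uniqueness of the solution identifies the implicit function with `timeFn` near `z`. -/
theorem contDiffAt_timeFn {a b : ℝ} (ha : 0 < a) (hb : 0 < b) {z : C4 n} (hz : z ≠ 0) :
    ContDiffAt ℝ ∞ (timeFn a b) z := by
  set u : C4 n × ℝ := (z, timeFn a b z) with hu
  have hf := (contDiff_flowNorm (n := n) a b).contDiffAt (x := u)
  have h1 : fderiv ℝ (fun p : C4 n × ℝ => flowNorm a b p.1 p.2) u (0, 1)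
      = ∑ A, -(2 * weight a b A.1 * (Real.exp (-(2 * weight a b A.1 * timeFn a b z))
        * ‖z A‖ ^ 2)) := by
    have h2 := (hf.differentiableAt (by simp)).hasFDerivAt.comp_hasDerivAt (timeFn a b z)
      ((hasDerivAt_const (timeFn a b z) z).prodMk (hasDerivAt_id (timeFn a b z)))
    exact h2.unique (hasDerivAt_flowNorm a b z (timeFn a b z))
  have hinv : (fderiv ℝ (fun p : C4 n × ℝ => flowNorm a b p.1 p.2) u ∘L
      .inr ℝ (C4 n) ℝ).IsInvertible := by
    refine ⟨ContinuousLinearEquiv.unitsEquivAut ℝ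
      (Units.mk0 _ (flowNorm_deriv_neg ha hb hz (timeFn a b z)).ne), ?_⟩
    ext
    simp [h1]
  refine (hf.contDiffAt_implicitFunction (by simp) hinv).congr_of_eventuallyEq ?_
  filter_upwards [hf.eventually_apply_implicitFunction (by simp) hinv,
    isOpen_ne.mem_nhds hz] with y hy hy0
  exact timeFn_eq ha hb hy0 (hy.trans (flowNorm_timeFn ha hb hz))

theorem isOpen_ne_zero : IsOpen {y : C4 n | y ≠ 0} := isOpen_ne

/-- A fundamental-domain neighbourhood on which the projection is injective. -/
def slab (a b t₀ : ℝ) : Set (C4 n) := {y | y ≠ 0 ∧ |timeFn a b y - t₀| < 1 / 2}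

theorem mem_slab_timeFn {a b : ℝ} {y : C4 n} (hy : y ≠ 0) : y ∈ slab a b (timeFn a b y) := ⟨hy, by simp⟩

theorem isOpen_slab {a b : ℝ} [ha : Fact (0 < a)] [hb : Fact (0 < b)] (t₀ : ℝ) :
    IsOpen (slab (n := n) a b t₀) := by
  have hc : ContinuousOn (fun y => |timeFn a b y - t₀|) {y : C4 n | y ≠ 0} := fun y hy =>
    ((contDiffAt_timeFn ha.out hb.out hy).continuousAt.sub continuousAt_const).abs.continuousWithinAt
  exact hc.isOpen_inter_preimage isOpen_ne_zero isOpen_Iio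

end Flow

/-! ### The quotient as a topological space -/

section Quotient

open Filter Topology

variable {n : ℕ}

theorem phi_zpow (a b : ℝ) (k : ℤ) : (phi a b : Equiv.Perm (puncturedC4 n)) ^ k
    = phi (k * a) (k * b) := by
  have h1 (k : ℤ) : (phi a b : Equiv.Perm (puncturedC4 n)) * phi (k * a) (k * b)
      = phi ((k + 1 : ℤ) * a) ((k + 1 : ℤ) * b) := by
    ext1 z
    refine Subtype.ext ((phiLin_phiLin _ _ _ _ _).trans ?_)
    have h (c : ℝ) : c + k * c = ((k + 1 : ℤ) : ℝ) * c := by push_cast; ring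
    rw [h, h]
    rfl
  induction k with
  | zero =>
    ext1 z
    refine Subtype.ext ?_
    change z.1 = phiLin ((0 : ℤ) * a) ((0 : ℤ) * b) z.1
    simp [phiLin_zero]
  | succ k ih => rw [add_comm, zpow_one_add, ih, h1, add_comm]
  | pred k ih =>
    have h2 := h1 (-k - 1)
    rw [sub_add_cancel, ← ih] at h2
    rw [← mul_right_inj (phi a b), h2, ← zpow_one_add, add_sub_cancel]

theorem projMab_eq_iff {a b : ℝ} {z w : puncturedC4 n} :
    projMab a b z = projMab a b w ↔ ∃ k : ℤ, z.1 = phiLin (k * a) (k * b) w.1 := by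
  rw [projMab, projMab, Quotient.eq, MulAction.orbitRel_apply, MulAction.mem_orbit_iff]
  constructor
  · rintro ⟨⟨g, hg⟩, h⟩
    obtain ⟨k, rfl⟩ := Subgroup.mem_zpowers_iff.1 hg
    have h' : (phi a b ^ k) w = z := h
    rw [phi_zpow] at h'
    exact ⟨k, (congrArg Subtype.val h').symm⟩
  · rintro ⟨k, h⟩
    refine ⟨⟨phi a b ^ k, Subgroup.mem_zpowers_iff.2 ⟨k, rfl⟩⟩, ?_⟩
    change (phi a b ^ k) w = z
    rw [phi_zpow]
    exact Subtype.ext h.symm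

theorem continuous_phi (a b : ℝ) : Continuous (phi a b : puncturedC4 n → puncturedC4 n) :=
  ((phiLin a b).continuous.comp continuous_subtype_val).subtype_mk _

theorem isOpenMap_projMab (a b : ℝ) : IsOpenMap (projMab a b : puncturedC4 n → Mab n a b) := by
  have : ContinuousConstSMul (Gam n a b) (puncturedC4 n) := ⟨by
    rintro ⟨g, hg⟩
    obtain ⟨k, rfl⟩ := Subgroup.mem_zpowers_iff.1 hg
    change Continuous (phi a b ^ k : Equiv.Perm (puncturedC4 n))
    rw [phi_zpow]
    exact continuous_phi _ _⟩
  exact isOpenMap_quotient_mk'_mul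

theorem continuous_projMab (a b : ℝ) : Continuous (projMab a b : puncturedC4 n → Mab n a b) :=
  continuous_quotient_mk'

theorem projMab_out {a b : ℝ} (x : Mab n a b) : projMab a b (Quotient.out x) = x := Quotient.out_eq x

variable [NeZero n]

/-- The point of the punctured space with given coordinates (and some point for zero). -/
def toPunctured (y : C4 n) : puncturedC4 n :=
  open Classical in
  if h : y ≠ 0 then ⟨y, h⟩ else ⟨1, by
    have : Nonempty (Fin 4 × Fin n) := ⟨(0, 0)⟩
    exact one_ne_zero⟩

theorem toPunctured_of_ne {y : C4 n} (h : y ≠ 0) : toPunctured y = ⟨y, h⟩ := dif_pos h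

theorem toPunctured_val (z : puncturedC4 n) : toPunctured z.1 = z := toPunctured_of_ne z.2

/-- The projection to the quotient as a function on the whole vector space. -/
def projE (a b : ℝ) (y : C4 n) : Mab n a b := projMab a b (toPunctured y)

theorem projE_val (a b : ℝ) (z : puncturedC4 n) : projE a b z.1 = projMab a b z := by
  rw [projE, toPunctured_val]

theorem projMab_eq {a b : ℝ} : (projMab a b : puncturedC4 n → Mab n a b) = projE a b ∘ Subtype.val :=
  funext fun z => (projE_val a b z).symm

theorem projE_eq_iff {a b : ℝ} {y z : C4 n} (hy : y ≠ 0) (hz : z ≠ 0) :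
    projE a b y = projE a b z ↔ ∃ k : ℤ, y = phiLin (k * a) (k * b) z := by
  rw [projE, projE, toPunctured_of_ne hy, toPunctured_of_ne hz, projMab_eq_iff]

theorem projE_phiLin (a b : ℝ) (k : ℤ) {y : C4 n} (hy : y ≠ 0) :
    projE a b (phiLin (k * a) (k * b) y) = projE a b y :=
  (projE_eq_iff (phiLin_ne_zero _ _ hy) hy).2 ⟨k, rfl⟩

theorem exists_projE_eq {a b : ℝ} (x : Mab n a b) : ∃ y : C4 n, y ≠ 0 ∧ projE a b y = x := by
  obtain ⟨z, rfl⟩ := Quotient.exists_rep x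
  exact ⟨z.1, z.2, projE_val a b z⟩

theorem continuousOn_projE (a b : ℝ) : ContinuousOn (projE (n := n) a b) {y | y ≠ 0} := by
  rw [continuousOn_iff_continuous_domRestrict]
  exact (continuous_projMab a b).congr fun z => (projE_val a b z).symm

theorem isOpen_image_projE (a b : ℝ) {s : Set (C4 n)} (hs : IsOpen s) (h0 : ∀ y ∈ s, y ≠ 0) :
    IsOpen (projE a b '' s) := by
  have h := isOpenMap_projMab (n := n) a b _ (hs.preimage continuous_subtype_val)
  convert! h using 1
  ext x
  constructor
  · rintro ⟨y, hy, rfl⟩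
    exact ⟨⟨y, h0 y hy⟩, hy, (projE_val a b ⟨y, h0 y hy⟩).symm⟩
  · rintro ⟨z, hz, rfl⟩
    exact ⟨z.1, hz, projE_val a b z⟩

variable {a b : ℝ} [ha : Fact (0 < a)] [hb : Fact (0 < b)]

/-- Points of one orbit have times differing by an integer `k`, and inside a slab `|k| < 1`. -/
theorem injOn_projE_slab (t₀ : ℝ) : Set.InjOn (projE a b) (slab (n := n) a b t₀) := by
  intro y hy z hz h
  obtain ⟨k, rfl⟩ := (projE_eq_iff hy.1 hz.1).1 h
  have h1 := hy.2
  have h2 := hz.2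
  rw [timeFn_phiLin ha.out hb.out hz.1] at h1
  rw [abs_lt] at h1 h2
  have h3 : (k : ℝ) < 1 := by linarith
  have h4 : (-1 : ℝ) < k := by linarith
  have h5 : k < 1 := by exact_mod_cast h3
  have h6 : -1 < k := by exact_mod_cast h4
  obtain rfl : k = 0 := by omega
  simp [phiLin_zero]

variable (n a b) in
/-- The local parametrization of the quotient by a slab. -/
def slabParam (t₀ : ℝ) : OpenPartialHomeomorph (C4 n) (Mab n a b) :=
  OpenPartialHomeomorph.ofContinuousOpenRestrict
    ((injOn_projE_slab (a := a) (b := b) t₀).toPartialEquiv (projE a b) (slab a b t₀))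
    ((continuousOn_projE a b).mono fun _ hy => hy.1)
    (by
      intro s hs
      obtain ⟨u, hu, rfl⟩ := isOpen_induced_iff.1 hs
      have h := isOpen_image_projE a b (hu.inter (isOpen_slab (a := a) (b := b) t₀))
        fun y hy => hy.2.1
      convert! h using 1
      ext x
      constructor
      · rintro ⟨y, hy, rfl⟩
        exact ⟨y.1, ⟨hy, y.2⟩, rfl⟩
      · rintro ⟨y, hy, rfl⟩
        exact ⟨⟨y, hy.2⟩, hy.1, rfl⟩)
    (isOpen_slab t₀)

theorem slabParam_symm_mem {t₀ : ℝ} {x : Mab n a b} (hx : x ∈ (slabParam n a b t₀).target) :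
    (slabParam n a b t₀).symm x ∈ slab a b t₀ := (slabParam n a b t₀).map_target hx

theorem projE_slabParam_symm {t₀ : ℝ} {x : Mab n a b} (hx : x ∈ (slabParam n a b t₀).target) :
    projE a b ((slabParam n a b t₀).symm x) = x := (slabParam n a b t₀).right_inv hx

theorem slabParam_symm_projE {t₀ : ℝ} {y : C4 n} (hy : y ∈ slab a b t₀) :
    (slabParam n a b t₀).symm (projE a b y) = y := (slabParam n a b t₀).left_inv hy

/-- Local inverses of the projection, composed with the projection, are given by elements of the
group. -/
theorem exists_slabParam_symm_projE_eq {t₀ : ℝ} {y : C4 n} (hy : y ≠ 0)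
    (hx : projE a b y ∈ (slabParam n a b t₀).target) :
    ∃ k : ℤ, ∀ᶠ z in 𝓝 y,
      (slabParam n a b t₀).symm (projE a b z) = phiLin (k * a) (k * b) z := by
  obtain ⟨k, hk⟩ := (projE_eq_iff (slabParam_symm_mem hx).1 hy).1 (projE_slabParam_symm hx)
  refine ⟨k, ?_⟩
  have h1 : phiLin (k * a) (k * b) y ∈ slab a b t₀ := hk ▸ slabParam_symm_mem hx
  filter_upwards [isOpen_ne_zero.mem_nhds hy, (phiLin (k * a) (k * b)).continuous.continuousAt
    ((isOpen_slab t₀).mem_nhds h1)] with z hz0 hz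
  rw [← projE_phiLin a b k hz0, slabParam_symm_projE hz]

/-! ### The manifold structure -/

/-- The atlas of local inverses of the projection. -/
instance Mab.chartedSpace : ChartedSpace (C4 n) (Mab n a b) where
  atlas := Set.range fun t₀ => (slabParam n a b t₀).symm
  chartAt x := (slabParam n a b (timeFn a b (Classical.choose (exists_projE_eq x)))).symm
  mem_chart_source x := by
    have h := Classical.choose_spec (exists_projE_eq x)
    exact ⟨_, ⟨h.1, by simp⟩, h.2⟩
  chart_mem_atlas x := ⟨_, rfl⟩

theorem chartAt_ne_zero (x : Mab n a b) {x' : Mab n a b} (hx' : x' ∈ (chartAt (C4 n) x).source) :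
    chartAt (C4 n) x x' ≠ 0 :=
  ((chartAt (C4 n) x).map_source hx' : chartAt (C4 n) x x' ∈ slab a b _).1

theorem projE_chartAt (x : Mab n a b) {x' : Mab n a b} (hx' : x' ∈ (chartAt (C4 n) x).source) :
    projE a b (chartAt (C4 n) x x') = x' := (chartAt (C4 n) x).left_inv hx'

theorem exists_chartAt_projE_eq (x : Mab n a b) {y : C4 n} (hy : y ≠ 0)
    (hx : projE a b y ∈ (chartAt (C4 n) x).source) :
    ∃ k : ℤ, ∀ᶠ z in 𝓝 y, chartAt (C4 n) x (projE a b z) = phiLin (k * a) (k * b) z :=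
  exists_slabParam_symm_projE_eq hy hx

end Quotient

/-! ### Smoothness of the projection -/

section Smooth

open Filter Topology

variable {n : ℕ} [NeZero n] {a b : ℝ} [ha : Fact (0 < a)] [hb : Fact (0 < b)]
  {𝕜 : Type*} [NontriviallyNormedField 𝕜] [NormedSpace 𝕜 (C4 n)] {m : ℕ∞ω}

/-- The transition maps are locally the maps `φ_{ka,kb}`. Stating this for a general field and
smoothness serves both the complex analytic and the real smooth structure. -/
theorem Mab.isManifold_of_contDiff
    (h : ∀ k : ℤ, ContDiff 𝕜 m (phiLin (k * a) (k * b) : C4 n → C4 n)) :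
    IsManifold 𝓘(𝕜, C4 n) m (Mab n a b) := by
  refine isManifold_of_contDiffOn _ _ _ ?_
  rintro _ _ ⟨s, rfl⟩ ⟨t, rfl⟩
  rintro y ⟨hy, -⟩
  have hy1 : y ∈ slab a b s := hy.1
  have hy2 : projE a b y ∈ (slabParam n a b t).target := hy.2
  obtain ⟨k, hk⟩ := exists_slabParam_symm_projE_eq hy1.1 hy2
  refine ((h k).contDiffAt.congr_of_eventuallyEq ?_).contDiffWithinAt
  filter_upwards [hk] with z hz
  exact hz

instance Mab.isManifold_complex : IsManifold 𝓘(ℂ, C4 n) ω (Mab n a b) :=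
  Mab.isManifold_of_contDiff fun _ => ContinuousLinearMap.contDiff _

instance Mab.isManifold_real : IsManifold 𝓘(ℝ, C4 n) ∞ (Mab n a b) :=
  Mab.isManifold_of_contDiff fun k =>
    ((phiLin (k * a) (k * b) : C4 n →L[ℂ] C4 n).restrictScalars ℝ).contDiff

theorem contMDiffOn_slabParam [IsManifold 𝓘(𝕜, C4 n) m (Mab n a b)] (t₀ : ℝ) :
    ContMDiffOn 𝓘(𝕜, C4 n) 𝓘(𝕜, C4 n) m (projE a b : C4 n → Mab n a b) (slab a b t₀) :=
  contMDiffOn_symm_of_mem_maximalAtlas (e := (slabParam n a b t₀).symm)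
    (IsManifold.subset_maximalAtlas ⟨t₀, rfl⟩)

theorem contMDiffOn_slabParam_symm [IsManifold 𝓘(𝕜, C4 n) m (Mab n a b)] (t₀ : ℝ) :
    ContMDiffOn 𝓘(𝕜, C4 n) 𝓘(𝕜, C4 n) m (slabParam n a b t₀).symm (slabParam n a b t₀).target :=
  contMDiffOn_of_mem_maximalAtlas (e := (slabParam n a b t₀).symm)
    (IsManifold.subset_maximalAtlas ⟨t₀, rfl⟩)

theorem contMDiffAt_projE [IsManifold 𝓘(𝕜, C4 n) m (Mab n a b)] {y : C4 n} (hy : y ≠ 0) :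
    ContMDiffAt 𝓘(𝕜, C4 n) 𝓘(𝕜, C4 n) m (projE a b : C4 n → Mab n a b) y :=
  (contMDiffOn_slabParam (timeFn a b y)).contMDiffAt
    ((isOpen_slab _).mem_nhds (mem_slab_timeFn hy))

theorem contMDiffAt_toPunctured {y : C4 n} (hy : y ≠ 0) :
    ContMDiffAt 𝓘(𝕜, C4 n) 𝓘(𝕜, C4 n) m (toPunctured : C4 n → puncturedC4 n) y := by
  have he : Subtype.val ∘ toPunctured =ᶠ[𝓝 y] (id : C4 n → C4 n) := by
    filter_upwards [isOpen_ne_zero.mem_nhds hy] with z hz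
    simp only [Function.comp_apply, toPunctured_of_ne hz]
    rfl
  rw [contMDiffAt_iff_target]
  exact ⟨Topology.IsInducing.subtypeVal.continuousAt_iff.2 (continuousAt_id.congr he.symm),
    contMDiffAt_id.congr_of_eventuallyEq he⟩

theorem isLocalDiffeomorph_projMab [IsManifold 𝓘(𝕜, C4 n) m (Mab n a b)] :
    IsLocalDiffeomorph 𝓘(𝕜, C4 n) 𝓘(𝕜, C4 n) m (projMab (n := n) a b) := by
  intro z
  let t₀ := timeFn a b z.1
  refine ⟨{
    toFun := projMab a b
    invFun := fun x => toPunctured ((slabParam n a b t₀).symm x)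
    source := Subtype.val ⁻¹' slab a b t₀
    target := (slabParam n a b t₀).target
    map_source' := fun w hw => ?_
    map_target' := fun x hx => ?_
    left_inv' := fun w hw => ?_
    right_inv' := fun x hx => ?_
    open_source := (isOpen_slab t₀).preimage continuous_subtype_val
    open_target := (slabParam n a b t₀).open_target
    contMDiffOn_toFun := ?_
    contMDiffOn_invFun := ?_ }, mem_slab_timeFn z.2, fun _ _ => rfl⟩
  · rw [← projE_val]
    exact (slabParam n a b t₀).map_source hw
  · rw [Set.mem_preimage, toPunctured_of_ne (slabParam_symm_mem hx).1]
    exact slabParam_symm_mem hx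
  · rw [← projE_val, slabParam_symm_projE hw, toPunctured_val]
  · exact projE_slabParam_symm hx
  · rw [projMab_eq]
    exact (contMDiffOn_slabParam t₀).comp contMDiff_subtype_val.contMDiffOn fun _ hw => hw
  · intro x hx
    exact (contMDiffAt_toPunctured (slabParam_symm_mem hx).1).comp_contMDiffWithinAt x
      (contMDiffOn_slabParam_symm t₀ x hx)

/-- A map on the quotient is smooth if its composition with the projection is. -/
theorem contMDiff_of_comp_projE [IsManifold 𝓘(𝕜, C4 n) m (Mab n a b)]
    {F H N : Type*} [NormedAddCommGroup F] [NormedSpace 𝕜 F]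
    [TopologicalSpace H] {I : ModelWithCorners 𝕜 F H} [TopologicalSpace N] [ChartedSpace H N]
    {f : Mab n a b → N}
    (hf : ∀ y, y ≠ 0 → ContMDiffAt 𝓘(𝕜, C4 n) I m (f ∘ projE a b) y) :
    ContMDiff 𝓘(𝕜, C4 n) I m f := by
  intro x
  have hx := mem_chart_source (C4 n) x
  have h1 := (hf _ (chartAt_ne_zero x hx)).comp x (contMDiffAt_of_mem_maximalAtlas
    (I := 𝓘(𝕜, C4 n)) (n := m) (IsManifold.chart_mem_maximalAtlas x) hx)
  refine h1.congr_of_eventuallyEq ?_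
  filter_upwards [(chartAt (C4 n) x).open_source.mem_nhds hx] with x' hx'
  simp only [Function.comp_apply, projE_chartAt x hx']

theorem comp_projE_contMDiffAt [IsManifold 𝓘(𝕜, C4 n) m (Mab n a b)]
    {F H N : Type*} [NormedAddCommGroup F] [NormedSpace 𝕜 F]
    [TopologicalSpace H] {I : ModelWithCorners 𝕜 F H} [TopologicalSpace N] [ChartedSpace H N]
    {f : Mab n a b → N} (hf : ContMDiff 𝓘(𝕜, C4 n) I m f) {y : C4 n} (hy : y ≠ 0) :
    ContMDiffAt 𝓘(𝕜, C4 n) I m (f ∘ projE a b) y :=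
  hf.contMDiffAt.comp y (contMDiffAt_projE hy)

/-- The derivative of a map of manifolds, as a linear map of the model spaces. -/
def modelDeriv {E E' M N : Type*} [NormedAddCommGroup E] [NormedSpace ℝ E] [NormedAddCommGroup E']
    [NormedSpace ℝ E'] [TopologicalSpace M] [ChartedSpace E M] [TopologicalSpace N]
    [ChartedSpace E' N] (f : M → N) (x : M) : E →L[ℝ] E' :=
  mfderiv 𝓘(ℝ, E) 𝓘(ℝ, E') f x

/-- In the distinguished charts, the projection is an element of the group near every point. -/
theorem exists_modelDeriv_projE_eq {y : C4 n} (hy : y ≠ 0) : ∃ k : ℤ,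
    chartAt (C4 n) (projE a b y) (projE a b y) = phiLin (k * a) (k * b) y ∧
    ∀ v : C4 n, modelDeriv (projE a b : C4 n → Mab n a b) y v = phiLin (k * a) (k * b) v := by
  obtain ⟨k, hk⟩ := exists_chartAt_projE_eq (projE a b y) hy (mem_chart_source _ _)
  refine ⟨k, hk.self_of_nhds, fun v => ?_⟩
  have hd : MDifferentiableAt 𝓘(ℝ, C4 n) 𝓘(ℝ, C4 n) (projE a b : C4 n → Mab n a b) y :=
    (contMDiffAt_projE (m := ∞) hy).mdifferentiableAt (by simp)
  have he : writtenInExtChartAt 𝓘(ℝ, C4 n) 𝓘(ℝ, C4 n) y (projE a b : C4 n → Mab n a b)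
      =ᶠ[𝓝 y] (phiLin (k * a) (k * b) : C4 n →L[ℂ] C4 n).restrictScalars ℝ := by
    filter_upwards [hk] with z hz
    exact hz
  have h2 : HasMFDerivAt 𝓘(ℝ, C4 n) 𝓘(ℝ, C4 n) (projE a b : C4 n → Mab n a b) y
      ((phiLin (k * a) (k * b) : C4 n →L[ℂ] C4 n).restrictScalars ℝ) :=
    ⟨hd.continuousAt, (((phiLin (k * a) (k * b) : C4 n →L[ℂ] C4 n).restrictScalars
      ℝ).hasFDerivAt.congr_of_eventuallyEq he).hasFDerivWithinAt⟩
  exact DFunLike.congr_fun h2.mfderiv v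

end Smooth

/-! ### The diffeomorphism with the product of a circle and a sphere -/

section Product

open Filter Topology

variable {n : ℕ}

theorem exists_sphereCoord (n : ℕ) [NeZero n] :
    ∃ L : C4 n ≃L[ℝ] EuclideanSpace ℝ (Fin (8 * n - 1 + 1)), ∀ z, ‖L z‖ ^ 2 = ∑ A, ‖z A‖ ^ 2 := by
  let V := PiLp 2 fun _ : Fin 4 × Fin n => ℂ
  -- The subtraction of naturals is harmless since `n` is nonzero; this form of the dimension
  -- matches the sphere of dimension `8 * n - 1`.
  have hrank : Module.finrank ℝ V = 8 * n - 1 + 1 := by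
    rw [← (PiLp.continuousLinearEquiv 2 ℝ fun _ : Fin 4 × Fin n => ℂ).symm.toLinearEquiv.finrank_eq,
      finrank_C4]
    have := NeZero.pos n
    omega
  let e := ((stdOrthonormalBasis ℝ V).reindex (finCongr hrank)).repr
  refine ⟨(PiLp.continuousLinearEquiv 2 ℝ fun _ : Fin 4 × Fin n => ℂ).symm.trans
    e.toContinuousLinearEquiv, fun z => ?_⟩
  rw [ContinuousLinearEquiv.trans_apply, LinearIsometryEquiv.coe_toContinuousLinearEquiv,
    LinearIsometryEquiv.norm_map, PiLp.norm_sq_eq_of_L2]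
  rfl

variable (n) in
/-- Real coordinates in which the Hermitian norm of `ℂ^{4n}` is the Euclidean norm. -/
def sphereCoord [NeZero n] : C4 n ≃L[ℝ] EuclideanSpace ℝ (Fin (8 * n - 1 + 1)) :=
  (exists_sphereCoord n).choose

theorem norm_sphereCoord [NeZero n] (z : C4 n) :
    ‖sphereCoord n z‖ ^ 2 = ∑ A, ‖z A‖ ^ 2 := (exists_sphereCoord n).choose_spec z

/-- The flow `φ_{ta,tb}`. -/
def diagFlow (a b t : ℝ) (z : C4 n) : C4 n := phiLin (t * a) (t * b) z

theorem diagFlow_diagFlow (a b s t : ℝ) (z : C4 n) :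
    diagFlow a b s (diagFlow a b t z) = diagFlow a b (s + t) z := by
  rw [diagFlow, diagFlow, phiLin_phiLin, diagFlow, add_mul, add_mul]

theorem diagFlow_zero (a b : ℝ) (z : C4 n) : diagFlow a b 0 z = z := by
  rw [diagFlow, zero_mul, zero_mul, phiLin_zero]

theorem diagFlow_ne_zero (a b t : ℝ) {z : C4 n} (hz : z ≠ 0) : diagFlow a b t z ≠ 0 :=
  phiLin_ne_zero _ _ hz

theorem contDiff_diagFlow (a b : ℝ) :
    ContDiff ℝ ∞ fun p : ℝ × C4 n => diagFlow a b p.1 p.2 := by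
  rw [contDiff_pi]
  intro A
  simp only [diagFlow, phiLin_apply, weight_mul]
  have h1 : ContDiff ℝ ∞ fun p : ℝ × C4 n => p.2 A :=
    (ContinuousLinearMap.proj (R := ℝ) (φ := fun _ : Fin 4 × Fin n => ℂ) A).contDiff.comp
      contDiff_snd
  have h2 : ContDiff ℝ ∞ fun p : ℝ × C4 n => Real.exp (p.1 * weight a b A.1) := by fun_prop
  exact (Complex.ofRealCLM.contDiff.comp h2).mul h1

theorem contDiffAt_diagFlow {a b : ℝ} {F : Type*} [NormedAddCommGroup F] [NormedSpace ℝ F]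
    {f : F → ℝ} {g : F → C4 n} {x : F} (hf : ContDiffAt ℝ ∞ f x) (hg : ContDiffAt ℝ ∞ g x) :
    ContDiffAt ℝ ∞ (fun y => diagFlow a b (f y) (g y)) x :=
  ContDiffAt.comp (g := fun p : ℝ × C4 n => diagFlow a b p.1 p.2) (f := fun y => (f y, g y)) x
    (contDiff_diagFlow a b).contDiffAt (hf.prodMk hg)

theorem contMDiffAt_diagFlow {a b : ℝ} {F H N : Type*} [NormedAddCommGroup F] [NormedSpace ℝ F]
    [TopologicalSpace H] {I : ModelWithCorners ℝ F H} [TopologicalSpace N] [ChartedSpace H N]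
    {f : N → ℝ} {g : N → C4 n} {x : N} (hf : ContMDiffAt I 𝓘(ℝ, ℝ) ∞ f x)
    (hg : ContMDiffAt I 𝓘(ℝ, C4 n) ∞ g x) :
    ContMDiffAt I 𝓘(ℝ, C4 n) ∞ (fun y => diagFlow a b (f y) (g y)) x :=
  ContMDiffAt.comp (I' := 𝓘(ℝ, ℝ × C4 n)) (g := fun p : ℝ × C4 n => diagFlow a b p.1 p.2)
    (f := fun y => (f y, g y)) x (contDiff_diagFlow a b).contMDiff.contMDiffAt
    (hf.prodMk_space hg)

theorem flowNorm_eq_norm [NeZero n] (a b : ℝ) (z : C4 n) (t : ℝ) :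
    flowNorm a b z t = ‖sphereCoord n (diagFlow a b (-t) z)‖ ^ 2 := by
  rw [norm_sphereCoord, show t = 0 - -t by ring, ← flowNorm_phiLin, sub_neg_eq_add, zero_add]
  simp [flowNorm, diagFlow]

theorem exp_timeFn_congr {a b : ℝ} [ha : Fact (0 < a)] [hb : Fact (0 < b)] {z w : puncturedC4 n}
    (h : projMab a b z = projMab a b w) :
    Circle.exp (timeFn a b z.1 * (2 * Real.pi)) = Circle.exp (timeFn a b w.1 * (2 * Real.pi)) := by
  obtain ⟨k, hk⟩ := projMab_eq_iff.1 h
  rw [hk, timeFn_phiLin ha.out hb.out w.2, Circle.exp_eq_exp]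
  exact ⟨k, by ring⟩

variable [NeZero n] {a b : ℝ}

variable (n a b) in
/-- The inverse of `toProduct`. -/
def ofProduct (p : Circle × Metric.sphere (0 : EuclideanSpace ℝ (Fin (8 * n - 1 + 1))) 1) :
    Mab n a b :=
  projE a b (diagFlow a b (Complex.arg p.1 / (2 * Real.pi)) ((sphereCoord n).symm p.2))

theorem sphereCoord_symm_ne_zero
    (s : Metric.sphere (0 : EuclideanSpace ℝ (Fin (8 * n - 1 + 1))) 1) :
    (sphereCoord n).symm (s : EuclideanSpace ℝ (Fin (8 * n - 1 + 1))) ≠ 0 := by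
  rw [Ne, EmbeddingLike.map_eq_zero_iff]
  exact ne_zero_of_mem_unit_sphere s

/-- Two logarithms `t` of the same circle point differ by an integer, that is, by an element of the
group. The discontinuity of `Complex.arg` is therefore invisible in the quotient. -/
theorem ofProduct_eq (c : Circle) (s : Metric.sphere (0 : EuclideanSpace ℝ (Fin (8 * n - 1 + 1))) 1)
    {t : ℝ} (ht : Circle.exp (t * (2 * Real.pi)) = c) :
    ofProduct n a b (c, s) = projE a b (diagFlow a b t ((sphereCoord n).symm s)) := by
  have hs := sphereCoord_symm_ne_zero s
  rw [← Circle.exp_arg c, Circle.exp_eq_exp] at ht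
  obtain ⟨m, hm⟩ := ht
  have h : t = m + Complex.arg c / (2 * Real.pi) := by
    have := Real.pi_pos
    field_simp
    linarith
  rw [h, ← diagFlow_diagFlow]
  exact (projE_phiLin a b m (diagFlow_ne_zero a b _ hs)).symm

variable [ha : Fact (0 < a)] [hb : Fact (0 < b)]

theorem norm_sphereCoord_diagFlow {z : C4 n} (hz : z ≠ 0) :
    ‖sphereCoord n (diagFlow a b (-timeFn a b z) z)‖ = 1 := by
  have h := flowNorm_eq_norm a b z (timeFn a b z)
  rw [flowNorm_timeFn ha.out hb.out hz] at h
  exact (pow_eq_one_iff_of_nonneg (norm_nonneg _) two_ne_zero).1 h.symm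

variable (a b) in
/-- The point of the unit sphere on the flow line through `z`. -/
def spherePart (z : puncturedC4 n) :
    Metric.sphere (0 : EuclideanSpace ℝ (Fin (8 * n - 1 + 1))) 1 :=
  ⟨sphereCoord n (diagFlow a b (-timeFn a b z.1) z.1), by
    rw [mem_sphere_zero_iff_norm]; exact norm_sphereCoord_diagFlow z.2⟩

theorem contMDiff_spherePart :
    ContMDiff 𝓘(ℝ, C4 n) (𝓡 (8 * n - 1)) ∞ (spherePart (n := n) a b) := by
  have := Fact.mk (@finrank_euclideanSpace_fin ℝ _ (8 * n - 1 + 1))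
  refine ContMDiff.codRestrict_sphere (f := fun z : puncturedC4 n =>
    sphereCoord n (diagFlow a b (-timeFn a b z.1) z.1)) ?_ _
  intro z
  have h0 : ContDiffAt ℝ ∞ (fun y : C4 n => diagFlow a b (-timeFn a b y) y) z.1 :=
    contDiffAt_diagFlow (contDiffAt_timeFn ha.out hb.out (z := z.1) z.2).neg contDiffAt_id
  have h : ContDiffAt ℝ ∞ (fun y : C4 n => sphereCoord n (diagFlow a b (-timeFn a b y) y)) z.1 :=
    ContDiff.comp_contDiffAt z.1 (sphereCoord n).contDiff h0
  exact contMDiffAt_subtype_iff.2 h.contMDiffAt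

theorem spherePart_congr {z w : puncturedC4 n} (h : projMab a b z = projMab a b w) :
    spherePart a b z = spherePart a b w := by
  obtain ⟨k, hk⟩ := projMab_eq_iff.1 h
  refine Subtype.ext ?_
  change sphereCoord n _ = sphereCoord n _
  rw [hk, timeFn_phiLin ha.out hb.out w.2]
  change sphereCoord n (diagFlow a b _ (diagFlow a b k w.1)) = _
  rw [diagFlow_diagFlow]
  congr 2
  ring

variable (n a b) in
/-- The map from the quotient to the product of a circle and a sphere. -/
def toProduct (x : Mab n a b) :
    Circle × Metric.sphere (0 : EuclideanSpace ℝ (Fin (8 * n - 1 + 1))) 1 :=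
  (Circle.exp (timeFn a b (Quotient.out x).1 * (2 * Real.pi)), spherePart a b (Quotient.out x))

theorem toProduct_projMab (z : puncturedC4 n) : toProduct n a b (projMab a b z)
    = (Circle.exp (timeFn a b z.1 * (2 * Real.pi)), spherePart a b z) := by
  have h := projMab_out (projMab a b z)
  rw [toProduct, spherePart_congr h, exp_timeFn_congr h]

theorem contMDiff_toProduct :
    ContMDiff 𝓘(ℝ, C4 n) ((𝓡 1).prod (𝓡 (8 * n - 1))) ∞ (toProduct n a b) := by
  refine contMDiff_of_comp_projE fun y hy => ?_
  have h1 : toProduct n a b ∘ projE a b =ᶠ[𝓝 y] fun y =>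
      (Circle.exp (timeFn a b y * (2 * Real.pi)), spherePart a b (toPunctured y)) := by
    filter_upwards [isOpen_ne_zero.mem_nhds hy] with z hz
    rw [Function.comp_apply, projE, toProduct_projMab, toPunctured_of_ne hz]
  refine ContMDiffAt.congr_of_eventuallyEq (ContMDiffAt.prodMk ?_ ?_) h1
  · exact contMDiff_circleExp.contMDiffAt.comp y
      ((contDiffAt_timeFn ha.out hb.out hy).mul contDiffAt_const).contMDiffAt
  · exact contMDiff_spherePart.contMDiffAt.comp y (contMDiffAt_toPunctured hy)

theorem timeFn_sphereCoord_symm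
    (s : Metric.sphere (0 : EuclideanSpace ℝ (Fin (8 * n - 1 + 1))) 1) :
    timeFn a b ((sphereCoord n).symm (s : EuclideanSpace ℝ (Fin (8 * n - 1 + 1)))) = 0 := by
  refine timeFn_eq ha.out hb.out (sphereCoord_symm_ne_zero s) ?_
  rw [flowNorm_eq_norm, neg_zero, diagFlow_zero]
  simp

theorem toProduct_ofProduct
    (p : Circle × Metric.sphere (0 : EuclideanSpace ℝ (Fin (8 * n - 1 + 1))) 1) :
    toProduct n a b (ofProduct n a b p) = p := by
  obtain ⟨c, s⟩ := p
  have hs := sphereCoord_symm_ne_zero s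
  have ht : timeFn a b (diagFlow a b (Complex.arg c / (2 * Real.pi))
      ((sphereCoord n).symm (s : EuclideanSpace ℝ (Fin (8 * n - 1 + 1)))))
      = Complex.arg c / (2 * Real.pi) := by
    rw [diagFlow, timeFn_phiLin ha.out hb.out hs, timeFn_sphereCoord_symm, zero_add]
  rw [ofProduct, projE, toProduct_projMab, toPunctured_of_ne (diagFlow_ne_zero a b _ hs)]
  refine Prod.ext ?_ (Subtype.ext ?_)
  · simp only [ht]
    rw [div_mul_cancel₀ _ Real.two_pi_pos.ne', Circle.exp_arg]
  · simp only [spherePart, ht]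
    rw [diagFlow_diagFlow, neg_add_cancel, diagFlow_zero, ContinuousLinearEquiv.apply_symm_apply]

theorem ofProduct_toProduct (x : Mab n a b) : ofProduct n a b (toProduct n a b x) = x := by
  obtain ⟨y, hy, rfl⟩ := exists_projE_eq x
  rw [projE, toProduct_projMab, toPunctured_of_ne hy, ofProduct_eq _ _ rfl]
  simp only [spherePart]
  rw [ContinuousLinearEquiv.symm_apply_apply, diagFlow_diagFlow, add_neg_cancel, diagFlow_zero,
    projE, toPunctured_of_ne hy]

theorem contMDiff_circle_coe :
    ContMDiff (𝓡 1) 𝓘(ℝ, ℂ) ∞ (fun c : Circle => (c : ℂ)) :=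
  letI := finrank_real_complex_fact'
  contMDiff_coe_sphere (E := ℂ)

theorem contMDiff_sphere_coe (d : ℕ) : ContMDiff (𝓡 d) 𝓘(ℝ, EuclideanSpace ℝ (Fin (d + 1))) ∞
    (fun s : Metric.sphere (0 : EuclideanSpace ℝ (Fin (d + 1))) 1 =>
      (s : EuclideanSpace ℝ (Fin (d + 1)))) :=
  have := Fact.mk (@finrank_euclideanSpace_fin ℝ _ (d + 1))
  contMDiff_coe_sphere

theorem contMDiff_ofProduct :
    ContMDiff ((𝓡 1).prod (𝓡 (8 * n - 1))) 𝓘(ℝ, C4 n) ∞ (ofProduct n a b) := by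
  rintro ⟨c₀, s₀⟩
  -- A branch of the logarithm adapted to `c₀`: the argument of `c / c₀`, smooth near `c₀`, plus the
  -- fixed argument of `c₀`.
  let τ : Circle → ℝ := fun c =>
    ((Complex.log (c * (c₀⁻¹ : Circle))).im + Complex.arg c₀) / (2 * Real.pi)
  have hτ (c : Circle) : Circle.exp (τ c * (2 * Real.pi)) = c := by
    rw [div_mul_cancel₀ _ Real.two_pi_pos.ne', Circle.exp_add, Circle.exp_arg, Complex.log_im,
      ← Circle.coe_mul, Circle.exp_arg, inv_mul_cancel_right]
  have hcd : ContDiffAt ℝ ∞ (fun w : ℂ => ((Complex.log (w * (c₀⁻¹ : Circle))).im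
      + Complex.arg c₀) / (2 * Real.pi)) c₀ := by
    have h1 : ContDiffAt ℝ ∞ Complex.log ((c₀ : ℂ) * (c₀⁻¹ : Circle)) := by
      refine (Complex.contDiffAt_log ?_).restrict_scalars ℝ
      rw [← Circle.coe_mul, mul_inv_cancel, Circle.coe_one]
      exact Complex.one_mem_slitPlane
    have h2 := h1.comp (c₀ : ℂ) (contDiffAt_id.mul contDiffAt_const)
    exact ((Complex.imCLM.contDiff.contDiffAt.comp (c₀ : ℂ) h2).add contDiffAt_const).div_const _
  have hτs : ContMDiffAt (𝓡 1) 𝓘(ℝ, ℝ) ∞ τ c₀ :=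
    hcd.contMDiffAt.comp c₀ contMDiff_circle_coe.contMDiffAt
  have h3 : ContMDiffAt ((𝓡 1).prod (𝓡 (8 * n - 1))) 𝓘(ℝ, C4 n) ∞
      (fun p : Circle × Metric.sphere (0 : EuclideanSpace ℝ (Fin (8 * n - 1 + 1))) 1 =>
        diagFlow a b (τ p.1) ((sphereCoord n).symm p.2)) (c₀, s₀) := by
    refine contMDiffAt_diagFlow (hτs.comp (c₀, s₀) contMDiffAt_fst) ?_
    have h4 : ContMDiff 𝓘(ℝ, EuclideanSpace ℝ (Fin (8 * n - 1 + 1))) 𝓘(ℝ, C4 n) ∞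
        (sphereCoord n).symm := (sphereCoord n).symm.contDiff.contMDiff
    exact ((h4.comp (contMDiff_sphere_coe (8 * n - 1))).comp contMDiff_snd).contMDiffAt
  refine ((contMDiffAt_projE (diagFlow_ne_zero a b _ (sphereCoord_symm_ne_zero s₀))).comp
    (c₀, s₀) h3).congr_of_eventuallyEq (.of_forall ?_)
  rintro ⟨c, s⟩
  exact ofProduct_eq c s (hτ c)

variable (n a b) in
/-- The quotient is diffeomorphic to the product of a circle and a sphere. -/
def diffeomorphProduct : Diffeomorph 𝓘(ℝ, C4 n) ((𝓡 1).prod (𝓡 (8 * n - 1))) (Mab n a b)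
    (Circle × Metric.sphere (0 : EuclideanSpace ℝ (Fin (8 * n - 1 + 1))) 1) ∞ where
  toFun := toProduct n a b
  invFun := ofProduct n a b
  left_inv := ofProduct_toProduct
  right_inv := toProduct_ofProduct
  contMDiff_toFun := contMDiff_toProduct
  contMDiff_invFun := contMDiff_ofProduct

/-- Separation, and likewise countability and compactness, are transported from the product of the
circle and the sphere. -/
instance Mab.t2Space : T2Space (Mab n a b) :=
  (diffeomorphProduct n a b).toHomeomorph.symm.t2Space

instance Mab.secondCountableTopology : SecondCountableTopology (Mab n a b) :=
  (diffeomorphProduct n a b).toHomeomorph.secondCountableTopology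

instance Mab.compactSpace : CompactSpace (Mab n a b) :=
  (diffeomorphProduct n a b).toHomeomorph.symm.compactSpace

end Product

/-! ### The conformal structure on the quotient -/

section ConformalStructure

open Filter Topology MetricCoord

/-- The value of a field of bilinear forms, on vectors of the model space. -/
def bilinVal {E M : Type*} [NormedAddCommGroup E] [NormedSpace ℝ E] [TopologicalSpace M]
    [ChartedSpace E M] (g : BilinField E M) (x : M) (v w : E) : ℝ := g x v w

theorem conformalScale_conformalScale {E M : Type*} [NormedAddCommGroup E] [NormedSpace ℝ E]
    [TopologicalSpace M] [ChartedSpace E M] (u v : M → ℝ) (g : BilinField E M) :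
    conformalScale u (conformalScale v g) = conformalScale (fun x => u x + v x) g := by
  funext x
  simp only [conformalScale, smul_smul, ← Real.exp_add, mul_add]

variable {n : ℕ}

theorem hasMFDerivAt_val (z : puncturedC4 n) :
    HasMFDerivAt 𝓘(ℝ, C4 n) 𝓘(ℝ, C4 n) (Subtype.val : puncturedC4 n → C4 n) z
      (ContinuousLinearMap.id ℝ (C4 n)) := by
  refine ⟨continuous_subtype_val.continuousAt,
    (HasFDerivAt.congr_of_eventuallyEq (hasFDerivAt_id (𝕜 := ℝ) z.1) ?_).hasFDerivWithinAt⟩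
  have ht := (extChartAt_target_mem_nhds (I := 𝓘(ℝ, C4 n)) z)
  filter_upwards [ht] with y hy
  exact (extChartAt 𝓘(ℝ, C4 n) z).right_inv hy

theorem hasMFDerivAt_phiLin (s t : ℝ) (y : C4 n) :
    HasMFDerivAt 𝓘(ℝ, C4 n) 𝓘(ℝ, C4 n) (phiLin s t : C4 n → C4 n) y
      ((phiLin s t : C4 n →L[ℂ] C4 n).restrictScalars ℝ) :=
  ((phiLin s t : C4 n →L[ℂ] C4 n).restrictScalars ℝ).hasFDerivAt.hasMFDerivAt

theorem modelDeriv_val (z : puncturedC4 n) (v : C4 n) :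
    modelDeriv (Subtype.val : puncturedC4 n → C4 n) z v = v :=
  DFunLike.congr_fun (hasMFDerivAt_val z).mfderiv v

/-! ### Representatives and induced maps on the quotient -/

/-- Coordinates of a representative of a point of the quotient. -/
def rep (a b : ℝ) (x : Mab n a b) : C4 n := (Quotient.out x).1

theorem rep_ne_zero {a b : ℝ} (x : Mab n a b) : rep a b x ≠ 0 := (Quotient.out x).2

/-- The map of the quotient that is induced by `φ_{s,t}`. -/
def inducedMap (a b s t : ℝ) (x : Mab n a b) : Mab n a b := projMab a b (phi s t (Quotient.out x))

/-- Diagonal maps commute, so `φ_{s,t}` maps orbits to orbits and the chosen representative does not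
matter. -/
theorem inducedMap_projMab {a b : ℝ} (s t : ℝ) (z : puncturedC4 n) :
    inducedMap a b s t (projMab a b z) = projMab a b (phi s t z) := by
  obtain ⟨k, hk⟩ := projMab_eq_iff.1 (projMab_out (projMab a b z))
  refine projMab_eq_iff.2 ⟨k, ?_⟩
  change phiLin s t (Quotient.out (projMab a b z)).1 = phiLin _ _ (phiLin s t z.1)
  rw [hk, phiLin_phiLin, phiLin_phiLin, add_comm s, add_comm t]

theorem inducedMap_inducedMap_neg {a b : ℝ} (s t : ℝ) (x : Mab n a b) :
    inducedMap a b s t (inducedMap a b (-s) (-t) x) = x := by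
  obtain ⟨z, rfl⟩ : ∃ z, projMab a b z = x := ⟨_, projMab_out x⟩
  rw [inducedMap_projMab, inducedMap_projMab]
  congr 1
  exact Subtype.ext (phiLin_phiLin_neg s t z.1)

/-- The permutation of the quotient that is induced by `φ_{s,t}`. -/
def inducedPerm (n : ℕ) (a b s t : ℝ) : Equiv.Perm (Mab n a b) where
  toFun := inducedMap a b s t
  invFun := inducedMap a b (-s) (-t)
  left_inv x := by simpa using inducedMap_inducedMap_neg (-s) (-t) x
  right_inv x := inducedMap_inducedMap_neg s t x

variable [NeZero n] (σ : Matrix (Fin n) (Fin n) ℂ) (a b : ℝ)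

variable {σ} in
theorem exists_metric_ne_zero (y : C4 n) : ∃ v w, metric σ y v w ≠ 0 := by
  by_contra! h
  have : Nonempty (Fin 4 × Fin n) := ⟨(0, 0)⟩
  exact one_ne_zero (metric_nondegenerate σ y (h 1))

theorem inducedMap_projE {a b : ℝ} (s t : ℝ) {y : C4 n} (hy : y ≠ 0) :
    inducedMap a b s t (projE a b y) = projE a b (phiLin s t y) := by
  rw [projE, inducedMap_projMab, projE, toPunctured_of_ne hy,
    toPunctured_of_ne (phiLin_ne_zero s t hy)]
  rfl

theorem inducedMap_comp_projE {a b : ℝ} (s t : ℝ) {y : C4 n} (hy : y ≠ 0) :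
    inducedMap a b s t ∘ projE a b =ᶠ[𝓝 y] projE a b ∘ phiLin s t := by
  filter_upwards [isOpen_ne_zero.mem_nhds hy] with z hz
  exact inducedMap_projE s t hz

theorem projE_rep {a b : ℝ} (x : Mab n a b) : projE a b (rep a b x) = x :=
  (projE_val a b _).trans (projMab_out x)

/-! ### The invariant metric and its conformal class -/

variable [ha : Fact (0 < a)] [hb : Fact (0 < b)]

/-- The metric on the quotient that is induced by the invariant metric `e^{-2(a+b)T} g`, where
`T` is the time function. -/
def quotientMetric : BilinField (C4 n) (Mab n a b) := fun x =>
  confMetric σ (fun y => -((a + b) * timeFn a b y)) (chartAt (C4 n) x x)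

variable {a b}

theorem modelDeriv_projE_surjective {y : C4 n} (hy : y ≠ 0) (V : C4 n) : ∃ v : C4 n,
    modelDeriv (projE a b : C4 n → Mab n a b) y v = V := by
  obtain ⟨k, -, h⟩ := exists_modelDeriv_projE_eq (a := a) (b := b) hy
  exact ⟨phiLin (-(k * a)) (-(k * b)) V, by rw [h, phiLin_phiLin_neg]⟩

theorem chartCoeff_apply (g : BilinField (C4 n) (Mab n a b)) (p : Mab n a b) (y v w : C4 n) :
    chartCoeff g p y v w = bilinVal g (projE a b y)
      (modelDeriv (projE a b) y v) (modelDeriv (projE a b) y w) := rfl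

theorem bilinVal_conformalScale_quotientMetric (v : Mab n a b → ℝ) (x : Mab n a b) (V W : C4 n) :
    bilinVal (conformalScale v (quotientMetric σ a b)) x V W
      = Real.exp (2 * (v x - (a + b) * timeFn a b (chartAt (C4 n) x x)))
        * metric σ (chartAt (C4 n) x x) V W := by
  change Real.exp (2 * v x) * (Real.exp (2 * -((a + b) * timeFn a b (chartAt (C4 n) x x)))
    * metric σ (chartAt (C4 n) x x) V W) = _
  rw [← mul_assoc, ← Real.exp_add, ← mul_add, ← sub_eq_add_neg]

/-- In the preferred chart at the image point, the projection is some `φ_{ka,kb}`. The homothety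
factor `e^{2k(a+b)}` cancels against the shift of the time function by `k`, so the coefficients
depend neither on `k` nor on the chart. -/
theorem chartCoeff_conformalScale_quotientMetric (v : Mab n a b → ℝ) (p : Mab n a b)
    {y : C4 n} (hy : y ≠ 0) : chartCoeff (conformalScale v (quotientMetric σ a b)) p y
      = confMetric σ (fun z => v (projE a b z) - (a + b) * timeFn a b z) y := by
  ext V W
  obtain ⟨k, hk, hd⟩ := exists_modelDeriv_projE_eq (a := a) (b := b) hy
  rw [chartCoeff_apply, bilinVal_conformalScale_quotientMetric, hd, hd, hk, metric_phiLin,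
    timeFn_phiLin ha.out hb.out hy, ← mul_assoc, ← Real.exp_add]
  change _ = Real.exp _ * _
  congr 2
  ring

variable {σ} in
theorem contDiffOn_conformalFactor {v : Mab n a b → ℝ}
    (hv : ContMDiff 𝓘(ℝ, C4 n) 𝓘(ℝ, ℝ) ∞ v) :
    ContDiffOn ℝ ∞ (fun z => v (projE a b z) - (a + b) * timeFn a b z) {z : C4 n | z ≠ 0} :=
  fun _ hy => ((comp_projE_contMDiffAt hv hy).contDiffAt.sub
    (contDiffAt_const.mul (contDiffAt_timeFn ha.out hb.out hy))).contDiffWithinAt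

theorem isSemiRiemannian_conformalScale {v : Mab n a b → ℝ}
    (hv : ContMDiff 𝓘(ℝ, C4 n) 𝓘(ℝ, ℝ) ∞ v) :
    IsSemiRiemannian (conformalScale v (quotientMetric σ a b)) where
  symm x := by
    suffices h : ∀ V W : C4 n, bilinVal (conformalScale v (quotientMetric σ a b)) x V W
      = bilinVal (conformalScale v (quotientMetric σ a b)) x W V from h
    intro V W
    rw [bilinVal_conformalScale_quotientMetric, bilinVal_conformalScale_quotientMetric,
      metric_symm]
  nondegenerate x := by
    suffices h : ∀ V : C4 n, (∀ W : C4 n,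
      bilinVal (conformalScale v (quotientMetric σ a b)) x V W = 0) → V = 0 from h
    intro V h
    refine metric_nondegenerate σ (chartAt (C4 n) x x) fun W => ?_
    have hW := h W
    rw [bilinVal_conformalScale_quotientMetric] at hW
    exact (mul_eq_zero.1 hW).resolve_left (Real.exp_ne_zero _)
  smooth p := by
    have hne : ∀ y ∈ (chartAt (C4 n) p).target, y ≠ 0 := fun y hy =>
      (show y ∈ slab a b _ from hy).1
    exact ((contDiffOn_confMetric (contDiffOn_conformalFactor hv)).mono hne).congr fun y hy =>
      chartCoeff_conformalScale_quotientMetric σ v p (hne y hy)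

theorem modelDeriv_projMab (z : puncturedC4 n) :
    (modelDeriv (projMab a b) z : C4 n →L[ℝ] C4 n) = modelDeriv (projE a b) z.1 := by
  have hd := ((contMDiffAt_projE (a := a) (b := b) (𝕜 := ℝ) (m := ∞) (y := z.1)
    z.2).mdifferentiableAt (by simp)).hasMFDerivAt.comp z (hasMFDerivAt_val z)
  rw [projMab_eq]
  exact hd.mfderiv

/-- Inverse charts agree with the projection as functions, so chart coefficients are the pull-back
to the punctured space, whatever the chart `p`. -/
theorem mem_inducedStructure_iff {g : BilinField (C4 n) (Mab n a b)} :
    g ∈ inducedStructure σ a b ↔ IsSemiRiemannian g ∧ ∃ u : puncturedC4 n → ℝ,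
      ContMDiff 𝓘(ℝ, C4 n) 𝓘(ℝ, ℝ) ∞ u ∧ ∀ (p : Mab n a b) (z : puncturedC4 n),
        chartCoeff g p z.1 = Real.exp (2 * u z) • metric σ z.1 := by
  refine and_congr_right fun _ => exists_congr fun u => and_congr_right fun _ => ?_
  have h (z : puncturedC4 n) (v w : C4 n) (p : Mab n a b) :
      (bilinVal g (projMab a b z) (modelDeriv (projMab a b) z v) (modelDeriv (projMab a b) z w)
        = Real.exp (2 * u z) * kaehlerMetric σ z.1
          (modelDeriv (Subtype.val : puncturedC4 n → C4 n) z v)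
          (modelDeriv (Subtype.val : puncturedC4 n → C4 n) z w))
      ↔ chartCoeff g p z.1 v w = (Real.exp (2 * u z) • metric σ z.1) v w := by
    rw [modelDeriv_val, modelDeriv_val, modelDeriv_projMab, chartCoeff_apply, projE_val,
      kaehlerMetric_eq]
    rfl
  refine ⟨fun hg p z => ?_, fun hg z v w => (h z v w (projMab a b z)).2 (by rw [hg])⟩
  ext v w
  exact (h z v w p).1 (hg z v w)

theorem conformalScale_zero (g : BilinField (C4 n) (Mab n a b)) :
    conformalScale (fun _ => 0) g = g := by
  funext x
  simp [conformalScale]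

theorem inducedStructure_subset {g : BilinField (C4 n) (Mab n a b)}
    {u : puncturedC4 n → ℝ} (hu : ContMDiff 𝓘(ℝ, C4 n) 𝓘(ℝ, ℝ) ∞ u)
    (h : ∀ (p : Mab n a b) (z : puncturedC4 n),
      chartCoeff g p z.1 = Real.exp (2 * u z) • metric σ z.1) :
    ∃ v : Mab n a b → ℝ, ContMDiff 𝓘(ℝ, C4 n) 𝓘(ℝ, ℝ) ∞ v ∧
      g = conformalScale v (quotientMetric σ a b) := by
  -- The logarithmic factor between `g` and the reference metric, as a function upstairs.
  let U : C4 n → ℝ := fun y => u (toPunctured y) + (a + b) * timeFn a b y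
  have hU {y : C4 n} (hy : y ≠ 0) (V W : C4 n) :
      bilinVal g (projE a b y) V W
        = Real.exp (2 * U y) * bilinVal (quotientMetric σ a b) (projE a b y) V W := by
    obtain ⟨v, rfl⟩ := modelDeriv_projE_surjective (a := a) (b := b) hy V
    obtain ⟨w, rfl⟩ := modelDeriv_projE_surjective (a := a) (b := b) hy W
    have h0 := chartCoeff_conformalScale_quotientMetric σ (fun _ => 0) (projE a b y) hy
    have h2 := h (projE a b y) ⟨y, hy⟩
    rw [conformalScale_zero] at h0
    rw [← chartCoeff_apply g (projE a b y),
      ← chartCoeff_apply (quotientMetric σ a b) (projE a b y), h0, confMetric, h2]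
    simp only [smul_apply, smul_eq_mul, U, toPunctured_of_ne hy]
    rw [← mul_assoc, ← Real.exp_add]
    congr 2
    ring
  -- Both metrics live on the quotient and the reference metric is nonzero somewhere on each tangent
  -- space, so their ratio is constant on orbits and `U` descends.
  have hinv {y z : C4 n} (hy : y ≠ 0) (hz : z ≠ 0) (hyz : projE a b y = projE a b z) :
      U y = U z := by
    obtain ⟨V, W, hVW⟩ := exists_metric_ne_zero (σ := σ)
      (chartAt (C4 n) (projE a b z) (projE a b z))
    have h1 := hU hy V W
    rw [hyz, hU hz V W] at h1
    have h2 := mul_right_cancel₀ (mul_ne_zero (Real.exp_ne_zero _) hVW) h1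
    have h3 := Real.exp_injective h2
    linarith
  refine ⟨fun x => U (rep a b x), contMDiff_of_comp_projE fun y hy => ?_, ?_⟩
  · have h1 : ContMDiffAt 𝓘(ℝ, C4 n) 𝓘(ℝ, ℝ) ∞ (fun y : C4 n => u (toPunctured y)) y :=
      hu.contMDiffAt.comp y (contMDiffAt_toPunctured hy)
    have h2 : ContDiffAt ℝ ∞ U y := h1.contDiffAt.add
      (contDiffAt_const.mul (contDiffAt_timeFn ha.out hb.out hy))
    refine h2.contMDiffAt.congr_of_eventuallyEq ?_
    filter_upwards [isOpen_ne_zero.mem_nhds hy] with z hz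
    exact hinv (rep_ne_zero _) hz (projE_rep _)
  · funext x
    have h2 := hU (rep_ne_zero x)
    rw [projE_rep] at h2
    exact ContinuousLinearMap.ext fun V => ContinuousLinearMap.ext fun W => h2 V W

theorem inducedStructure_eq :
    inducedStructure σ a b = conformalClass (quotientMetric (n := n) σ a b) := by
  ext g
  rw [mem_inducedStructure_iff]
  refine and_congr_right fun _ => ⟨fun ⟨u, hu, h⟩ => inducedStructure_subset σ hu h, ?_⟩
  rintro ⟨v, hv, rfl⟩
  refine ⟨fun z => v (projMab a b z) - (a + b) * timeFn a b z.1, ?_, fun p z => ?_⟩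
  · intro z
    have h1 := ((contDiffOn_conformalFactor hv).contDiffAt
      (isOpen_ne_zero.mem_nhds (x := z.1) z.2)).contMDiffAt
    have h2 := contMDiffAt_subtype_iff (U := puncturedC4 n) (x := z).2 h1
    simpa only [projE_val] using h2
  · rw [chartCoeff_conformalScale_quotientMetric σ v p z.2, confMetric, projE_val]

/-! ### Properties of the metrics in the conformal structure -/

theorem hasSignature_conformalScale (v : Mab n a b → ℝ) :
    HasSignature (conformalScale v (quotientMetric σ a b)) (4 * n) (4 * n) := by
  intro x
  obtain ⟨B, hB⟩ := exists_orthonormal_basis σ _ (Real.exp_pos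
    (2 * (v x - (a + b) * timeFn a b (chartAt (C4 n) x x)))) (chartAt (C4 n) x x)
  exact ⟨B, fun i j => (bilinVal_conformalScale_quotientMetric σ v x (B i) (B j)).trans (hB i j)⟩

theorem bilinVal_conformalScale_smul_I (v : Mab n a b → ℝ) (x : Mab n a b) (V W : C4 n) :
    bilinVal (conformalScale v (quotientMetric σ a b)) x (Complex.I • V) (Complex.I • W)
      = bilinVal (conformalScale v (quotientMetric σ a b)) x V W := by
  rw [bilinVal_conformalScale_quotientMetric, bilinVal_conformalScale_quotientMetric,
    metric_smul_I]

variable {σ} in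
theorem not_isConformallyFlat (hσ : σ ≠ 0) {v : Mab n a b → ℝ}
    (hv : ContMDiff 𝓘(ℝ, C4 n) 𝓘(ℝ, ℝ) ∞ v) :
    ¬ IsConformallyFlat (conformalScale v (quotientMetric σ a b)) := by
  intro h
  -- A vertical point; its chart coordinates are its image under a diagonal map and hence vertical
  -- too.
  have hy : (Pi.single (2, 0) 1 : C4 n) ≠ 0 := by simp
  let p : Mab n a b := projE a b (Pi.single (2, 0) 1)
  obtain ⟨k, hk, -⟩ := exists_modelDeriv_projE_eq (a := a) (b := b) hy
  have hc : IsVertical (chartAt (C4 n) p p) := fun i => by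
    rw [hk]
    simp [phiLin_apply]
  have hc0 : chartAt (C4 n) p p ≠ 0 := chartAt_ne_zero p (mem_chart_source _ p)
  obtain ⟨V, W, X, Y, hw⟩ := confMetric_exists_weyl_ne_zero hσ isOpen_ne_zero
    (contDiffOn_conformalFactor hv) hc0 hc
  refine hw ?_
  rw [← h p V W X Y, weyl_congr]
  filter_upwards [isOpen_ne_zero.mem_nhds hc0] with z hz
  exact (chartCoeff_conformalScale_quotientMetric σ v p hz).symm

theorem isLocallyConformallyRicciFlatKaehler {v : Mab n a b → ℝ}
    (hv : ContMDiff 𝓘(ℝ, C4 n) 𝓘(ℝ, ℝ) ∞ v) :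
    IsLocallyConformallyRicciFlatKaehler (conformalScale v (quotientMetric σ a b)) := by
  intro p
  -- This factor undoes both `v` and the time factor, with the time read in the single chart at `p`.
  refine ⟨(chartAt (C4 n) p).source, (chartAt (C4 n) p).open_source, mem_chart_source _ p,
    fun x => (a + b) * timeFn a b (chartAt (C4 n) p x) - v x, ?_, fun q hq => ?_⟩
  · intro x hx
    have h1 : ContMDiffAt 𝓘(ℝ, C4 n) 𝓘(ℝ, C4 n) ∞ (chartAt (C4 n) p) x :=
      contMDiffAt_of_mem_maximalAtlas (IsManifold.chart_mem_maximalAtlas p) hx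
    have h2 : ContMDiffAt 𝓘(ℝ, C4 n) 𝓘(ℝ, ℝ) ∞ (fun y => (a + b) * timeFn a b y)
        (chartAt (C4 n) p x) :=
      (contDiffAt_const.mul
        (contDiffAt_timeFn ha.out hb.out (chartAt_ne_zero p hx))).contMDiffAt
    exact ((h2.comp x h1).sub hv.contMDiffAt).contMDiffWithinAt
  · have hq0 := mem_chart_source (C4 n) q
    have hc0 : chartAt (C4 n) q q ≠ 0 := chartAt_ne_zero q hq0
    obtain ⟨k, hk⟩ := exists_chartAt_projE_eq p hc0 (by rwa [projE_chartAt q hq0])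
    -- The times read in the charts at `p` and `q` differ by a locally constant integer `k`, so near
    -- `q` the metric is a constant multiple of the Kähler metric.
    have he : chartCoeff (conformalScale
        (fun x => (a + b) * timeFn a b (chartAt (C4 n) p x) - v x)
        (conformalScale v (quotientMetric σ a b))) q =ᶠ[𝓝 (chartAt (C4 n) q q)]
        confMetric σ fun _ => (a + b) * k := by
      rw [conformalScale_conformalScale]
      filter_upwards [isOpen_ne_zero.mem_nhds hc0, hk] with z hz hkz
      rw [chartCoeff_conformalScale_quotientMetric σ _ q hz, confMetric, confMetric, hkz,
        timeFn_phiLin ha.out hb.out hz]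
      congr 3
      ring
    refine ⟨fun V W => ?_, isKaehlerAt_congr he (confMetric_const_isKaehlerAt σ _ _)⟩
    rw [ricci_congr he, confMetric_const_ricci]

/-! ### The essential conformal transformations -/

theorem contMDiff_inducedMap (s t : ℝ) :
    ContMDiff 𝓘(ℝ, C4 n) 𝓘(ℝ, C4 n) ∞ (inducedMap (n := n) a b s t) := by
  refine contMDiff_of_comp_projE fun y hy => ?_
  have h : ContMDiffAt 𝓘(ℝ, C4 n) 𝓘(ℝ, C4 n) ∞ (phiLin s t : C4 n → C4 n) y :=
    ((phiLin s t : C4 n →L[ℂ] C4 n).restrictScalars ℝ).contDiff.contMDiff.contMDiffAt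
  exact ((contMDiffAt_projE (phiLin_ne_zero s t hy)).comp y h).congr_of_eventuallyEq
    (inducedMap_comp_projE s t hy)

theorem modelDeriv_inducedMap (s t : ℝ) {y : C4 n} (hy : y ≠ 0) (v : C4 n) :
    (modelDeriv (inducedMap a b s t) (projE a b y) : C4 n →L[ℝ] C4 n) (modelDeriv (projE a b) y v)
      = modelDeriv (projE a b : C4 n → Mab n a b) (phiLin s t y) (phiLin s t v) := by
  have hp {y : C4 n} (hy : y ≠ 0) := ((contMDiffAt_projE (a := a) (b := b) (𝕜 := ℝ) (m := ∞)
    hy).mdifferentiableAt (by simp)).hasMFDerivAt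
  have h1 := ((contMDiff_inducedMap (n := n) (a := a) (b := b) s t).mdifferentiable (by simp)
    (projE a b y)).hasMFDerivAt.comp y (hp hy)
  have h2 := ((hp (phiLin_ne_zero s t hy)).comp y
    (hasMFDerivAt_phiLin s t y)).congr_of_eventuallyEq (inducedMap_comp_projE s t hy)
  exact DFunLike.congr_fun (hasMFDerivAt_unique h1 h2) v

theorem bilinVal_inducedMap (v : Mab n a b → ℝ) (s t : ℝ) {y : C4 n} (hy : y ≠ 0) (V W : C4 n) :
    bilinVal (conformalScale v (quotientMetric σ a b)) (inducedMap a b s t (projE a b y))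
      ((modelDeriv (inducedMap a b s t) (projE a b y) : C4 n →L[ℝ] C4 n)
        (modelDeriv (projE a b) y V))
      ((modelDeriv (inducedMap a b s t) (projE a b y) : C4 n →L[ℝ] C4 n)
        (modelDeriv (projE a b) y W))
    = Real.exp (2 * (v (projE a b (phiLin s t y)) - (a + b) * timeFn a b (phiLin s t y) + (s + t)))
      * metric σ y V W := by
  rw [modelDeriv_inducedMap s t hy, modelDeriv_inducedMap s t hy, inducedMap_projE s t hy,
    ← chartCoeff_apply _ (projE a b y),
    chartCoeff_conformalScale_quotientMetric σ v _ (phiLin_ne_zero s t hy), confMetric,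
    smul_apply, smul_apply, smul_eq_mul, metric_phiLin, ← mul_assoc, ← Real.exp_add, mul_add 2 (_ - _)]

theorem isConformalTransformation_inducedPerm {v : Mab n a b → ℝ}
    (hv : ContMDiff 𝓘(ℝ, C4 n) 𝓘(ℝ, ℝ) ∞ v) (s t : ℝ) :
    IsConformalTransformation (conformalScale v (quotientMetric σ a b)) (inducedPerm n a b s t) := by
  let h : C4 n → ℝ := fun z => v (projE a b z) - (a + b) * timeFn a b z
  -- With `e^{2h} g` the pulled-back metric, the factor of `φ_{s,t}` is `h ∘ φ_{s,t} - h` plus the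
  -- homothety exponent `s + t`. A group element shifts both values of `h` by the same amount, so
  -- `Λ` is invariant.
  let Λ : C4 n → ℝ := fun y => h (phiLin s t y) + (s + t) - h y
  have hΛ {y z : C4 n} (hy : y ≠ 0) (hz : z ≠ 0) (hyz : projE a b y = projE a b z) :
      Λ y = Λ z := by
    obtain ⟨k, rfl⟩ := (projE_eq_iff hy hz).1 hyz
    have h1 {w : C4 n} (hw : w ≠ 0) : h (phiLin (k * a) (k * b) w) = h w - (a + b) * k := by
      simp only [h]
      rw [projE_phiLin a b k hw, timeFn_phiLin ha.out hb.out hw]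
      ring
    have h2 : phiLin s t (phiLin (k * a) (k * b) z) = phiLin (k * a) (k * b) (phiLin s t z) := by
      rw [phiLin_phiLin, phiLin_phiLin, add_comm s, add_comm t]
    simp only [Λ]
    rw [h2, h1 hz, h1 (phiLin_ne_zero s t hz)]
    ring
  refine ⟨contMDiff_inducedMap s t, contMDiff_inducedMap (-s) (-t),
    fun x => Λ (rep a b x), contMDiff_of_comp_projE fun y hy => ?_, fun x V W => ?_⟩
  · have hh {y : C4 n} (hy : y ≠ 0) : ContDiffAt ℝ ∞ h y :=
      (contDiffOn_conformalFactor hv).contDiffAt (isOpen_ne_zero.mem_nhds hy)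
    have h1 : ContDiffAt ℝ ∞ Λ y :=
      (((hh (phiLin_ne_zero s t hy)).comp y
        ((phiLin s t : C4 n →L[ℂ] C4 n).restrictScalars ℝ).contDiff.contDiffAt).add
          contDiffAt_const).sub (hh hy)
    refine h1.contMDiffAt.congr_of_eventuallyEq ?_
    filter_upwards [isOpen_ne_zero.mem_nhds hy] with z hz
    exact hΛ (rep_ne_zero _) hz (projE_rep _)
  · suffices hx : ∀ V W : C4 n, bilinVal (conformalScale v (quotientMetric σ a b))
        (inducedMap a b s t x) ((modelDeriv (inducedMap a b s t) x : C4 n →L[ℝ] C4 n) V)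
        ((modelDeriv (inducedMap a b s t) x : C4 n →L[ℝ] C4 n) W) = Real.exp (2 * Λ (rep a b x))
          * bilinVal (conformalScale v (quotientMetric σ a b)) x V W from hx V W
    intro V' W'
    obtain ⟨y, hy, rfl⟩ := exists_projE_eq x
    obtain ⟨V, rfl⟩ := modelDeriv_projE_surjective (a := a) (b := b) hy V'
    obtain ⟨W, rfl⟩ := modelDeriv_projE_surjective (a := a) (b := b) hy W'
    rw [bilinVal_inducedMap σ v s t hy V W, hΛ (rep_ne_zero _) hy (projE_rep _),
      ← chartCoeff_apply _ (projE a b y), chartCoeff_conformalScale_quotientMetric σ v _ hy,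
      confMetric, smul_apply, smul_apply, smul_eq_mul, ← mul_assoc, ← Real.exp_add]
    congr 2
    simp only [Λ, h]
    ring

/-- The first block of `φ_{0,t}` has weight zero. -/
theorem phiLin_fixed (t : ℝ) : phiLin 0 t (Pi.single (0, 0) 1 : C4 n) = Pi.single (0, 0) 1 := by
  funext A
  rw [phiLin_apply]
  by_cases hA : A = (0, 0)
  · subst hA
    simp [weight]
  · simp [Pi.single_eq_of_ne hA]

/-- At a fixed point the values of any rescaling function before and after the map agree and cancel.
The factor `e^{2t}` is left, so an isometry would force `t = 0`. -/
theorem isEssential_inducedPerm (v : Mab n a b → ℝ) {t : ℝ} (ht : t ≠ 0) :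
    IsEssential (conformalScale v (quotientMetric σ a b)) (inducedPerm n a b 0 t) := by
  rintro ⟨g, ⟨-, w, -, rfl⟩, h⟩
  have h1 := (h _ (Subgroup.mem_zpowers _)).2.2
  rw [conformalScale_conformalScale] at h1
  have hy : (Pi.single (0, 0) 1 : C4 n) ≠ 0 := by simp
  obtain ⟨V, W, hVW⟩ := exists_metric_ne_zero (σ := σ) (Pi.single (0, 0) 1 : C4 n)
  have h2 := h1 (projE a b (Pi.single (0, 0) 1))
    ((modelDeriv (projE a b) (Pi.single (0, 0) 1 : C4 n) : C4 n →L[ℝ] C4 n) V)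
    ((modelDeriv (projE a b) (Pi.single (0, 0) 1 : C4 n) : C4 n →L[ℝ] C4 n) W)
  have h3 := (bilinVal_inducedMap σ (fun x => w x + v x) 0 t hy V W).symm.trans h2
  change _ = chartCoeff (conformalScale (fun x => w x + v x) (quotientMetric σ a b))
    (projE a b (Pi.single (0, 0) 1)) (Pi.single (0, 0) 1) V W at h3
  rw [chartCoeff_conformalScale_quotientMetric σ _ _ hy, phiLin_fixed] at h3
  have h4 := Real.exp_injective (mul_right_cancel₀ hVW h3)
  exact ht (by linarith)

end ConformalStructure

end

theorem theorem2p5 (n : ℕ) (σ : Matrix (Fin n) (Fin n) ℂ) (hsymm : σ.IsSymm) (hσ : σ ≠ 0)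
    (a b : ℝ) (ha : 0 < a) (hb : 0 < b) :
    -- the generator of the group is a homothety of the metric (it is complex linear)
    (∀ z v w : C4 n, kaehlerMetric σ (phiLin a b z) (phiLin a b v) (phiLin a b w)
      = Real.exp (2 * (a + b)) * kaehlerMetric σ z v w) ∧
    -- the quotient is a compact complex manifold, with the structure for which the projection
    -- is locally biholomorphic
    ∃ _ : ChartedSpace (C4 n) (Mab n a b),
      IsManifold 𝓘(ℂ, C4 n) ω (Mab n a b) ∧ IsManifold 𝓘(ℝ, C4 n) ∞ (Mab n a b) ∧
      IsLocalDiffeomorph 𝓘(ℂ, C4 n) 𝓘(ℂ, C4 n) ω (projMab (n := n) a b) ∧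
      T2Space (Mab n a b) ∧ SecondCountableTopology (Mab n a b) ∧ CompactSpace (Mab n a b) ∧
      -- diffeomorphic to the product of a circle and a sphere of dimension `8n - 1` (`n ≥ 1`,
      -- since `σ ≠ 0`)
      Nonempty (Diffeomorph 𝓘(ℝ, C4 n) ((𝓡 1).prod (𝓡 (8 * n - 1))) (Mab n a b)
        (Circle × Metric.sphere (0 : EuclideanSpace ℝ (Fin (8 * n - 1 + 1))) 1) ∞) ∧
      -- `g` induces a conformal structure on the quotient
      (∃ g₀, IsSemiRiemannian g₀ ∧ inducedStructure σ a b = conformalClass g₀) ∧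
      ∀ g' ∈ inducedStructure σ a b,
        HasSignature g' (4 * n) (4 * n) ∧
        ¬ IsConformallyFlat g' ∧
        IsLocallyConformallyRicciFlatKaehler g' ∧
        -- the complex structure preserves the conformal structure
        (∀ x v w, g' x (complexStructure x v) (complexStructure x w) = g' x v w) ∧
        -- the maps induced by `φ_{0,t}` are essential conformal transformations, with fixed points
        ∀ t : ℝ, t ≠ 0 → ∃ ψ : Equiv.Perm (Mab n a b),
          (∀ z, ψ (projMab a b z) = projMab a b (phi 0 t z)) ∧
          IsConformalTransformation g' ψ ∧ IsEssential g' ψ ∧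
          (∃ z : puncturedC4 n, phi 0 t z = z) ∧ ∃ x, ψ x = x := by
  -- For `n = 0` the matrix would be empty and hence zero.
  have : NeZero n := ⟨by
    rintro rfl
    exact hσ (Subsingleton.elim _ _)⟩
  have : Fact (0 < a) := ⟨ha⟩
  have : Fact (0 < b) := ⟨hb⟩
  refine ⟨fun z v w => ?_, Mab.chartedSpace, Mab.isManifold_complex, Mab.isManifold_real,
    isLocalDiffeomorph_projMab, Mab.t2Space, Mab.secondCountableTopology, Mab.compactSpace,
    ⟨diffeomorphProduct n a b⟩, ⟨quotientMetric σ a b, ?_, inducedStructure_eq σ⟩, ?_⟩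
  · rw [kaehlerMetric_eq, kaehlerMetric_eq, metric_phiLin]
  · have h := isSemiRiemannian_conformalScale σ
      (contMDiff_const (c := (0 : ℝ)) (I := 𝓘(ℝ, C4 n)) (M := Mab n a b))
    rwa [conformalScale_zero] at h
  · rw [inducedStructure_eq]
    rintro g ⟨-, v, hv, rfl⟩
    refine ⟨hasSignature_conformalScale σ v, not_isConformallyFlat hσ hv,
      isLocallyConformallyRicciFlatKaehler σ hv, bilinVal_conformalScale_smul_I σ v,
      fun t ht => ⟨inducedPerm n a b 0 t, inducedMap_projMab 0 t,
        isConformalTransformation_inducedPerm σ hv 0 t, isEssential_inducedPerm σ v ht, ?_⟩⟩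
    have hy : (Pi.single (0, 0) 1 : C4 n) ≠ 0 := by simp
    have hfix : phi 0 t (⟨Pi.single (0, 0) 1, hy⟩ : puncturedC4 n) = ⟨Pi.single (0, 0) 1, hy⟩ :=
      Subtype.ext (phiLin_fixed t)
    refine ⟨⟨_, hfix⟩, projMab a b ⟨Pi.single (0, 0) 1, hy⟩, ?_⟩
    exact (inducedMap_projMab 0 t _).trans (congrArg (projMab a b) hfix)
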